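/- **Setting.** Let $\mathcal X$ be a finite set with $q=|\mathcal X|\ge 2$, let $W:\mathcal X\to\mathcal Y$ be a discrete memoryless channel with at most countable output alphabet $\mathcal Y$ and transition probabilities $W(y\mid x)$, let $\ell\ge 2$, and let $g:\mathcal X^\ell\to\mathcal X^\ell$ be a bijection (an arbitrary, possibly non-linear, kernel). Put $$I(W)=\sum_{x\in\mathcal X}\sum_{y\in\mathcal Y}\frac1q W(y\mid x)\log_q\frac{W(y\mid x)}{\frac1q\sum_{x'}W(y\mid x')},\qquad Z_{x,x'}(W)=\sum_{y}\sqrt{W(y\mid x)W(y\mid x')},$$ $$Z(W)=\frac1{q(q-1)}\sum_{x\ne x'}Z_{x,x'}(W),\qquad Z_{\min}(W)=\min_{x,x'}Z_{x,x'}(W).$$ For $i\in\{0,\dots,\ell-1\}$ the subchannel $W^{(i)}:\mathcal X\to\mathcal Y^\ell\times\mathcal X^{i}$ is $$W^{(i)}(y_0^{\ell-1},u_0^{i-1}\mid u_i)=\frac1{q^{\ell-1}}\sum_{u_{i+1}^{\ell-1}}\prod_{j=0}^{\ell-1}W\big(y_j\mid g(u_0^{\ell-1})_j\big).$$ Let $B_1,B_2,\dots$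 be independent and uniformly distributed on $\{0,\dots,\ell-1\}$, write $W_n=W^{(B_1)\cdots(B_n)}$, and let $I_\infty(W)=\lim_{n\to\infty}I(W_n)$ (this limit exists almost surely). With $d$ the Hamming distance, let $$D^{[i]}_{x,x'}=\min_{u_0^{i-1}}\ \min_{v_{i+1}^{\ell-1},\,w_{i+1}^{\ell-1}}d\big(g(u_0^{i-1},x,v_{i+1}^{\ell-1}),\,g(u_0^{i-1},x',w_{i+1}^{\ell-1})\big),\qquad D^{[i]}_{\min}=\min_{x\ne x'}D^{[i]}_{x,x'},\qquad D^{[i]}_{\max}=\max_{x,x'}D^{[i]}_{x,x'},$$ $$E_1(g)=\frac1\ell\sum_i\log_\ell D^{[i]}_{\min},\quad V_1(g)=\frac1\ell\sum_i\big(\log_\ell D^{[i]}_{\min}-E_1(g)\big)^2,$$ $$E_2(g)=\frac1\ell\sum_i\log_\ell D^{[i]}_{\max},\quad V_2(g)=\frac1\ell\sum_i\big(\log_\ell D^{[i]}_{\max}-E_2(g)\big)^2,$$ and $Q(t)=\frac1{\sqrt{2\pi}}\int_t^\infty e^{-x^2/2}\,dx$. **Theorem.** Assume $P(I_\infty(W)\in\{0,1\})=1$,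 and let $t\in\mathbb R$ and $f(n)=o(\sqrt n)$ be arbitrary. 1. If $V_1(g)>0$, then $$\liminf_{n\to\infty}P\Big(Z(W_n)<2^{-\ell^{E_1(g)n+t\sqrt{V_1(g)n}+f(n)}}\Big)\ \ge\ I(W)\,Q(t).$$ 2. If $V_2(g)>0$ and $Z_{\min}(W)>0$, then $$\limsup_{n\to\infty}P\Big(Z(W_n)<2^{-\ell^{E_2(g)n+t\sqrt{V_2(g)n}+f(n)}}\Big)\ \le\ I(W)\,Q(t).$$ -/

import Mathlib

open Filter Topology MeasureTheory ProbabilityTheory Asymptotics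

universe u

/-- A discrete memoryless channel with input alphabet `X`: an at most countable output alphabet
`Out` and, for every input `x`, a probability distribution `y ↦ W(y ∣ x) = prob x y` on `Out`. -/
structure DMC (X : Type u) where
  Out : Type u
  countable_out : Countable Out
  prob : X → Out → ℝ
  prob_nonneg : ∀ x y, 0 ≤ prob x y
  prob_hasSum : ∀ x, HasSum (prob x) 1

/-- The vector `(u_0, …, u_{i-1}, x, v_{i+1}, …, v_{ℓ-1})`. -/
def joinVec {X : Type u} {ℓ : ℕ} (i : Fin ℓ) (u : {j : Fin ℓ // j < i} → X) (x : X)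
    (v : {j : Fin ℓ // i < j} → X) : Fin ℓ → X := fun j =>
  if h : j < i then u ⟨j, h⟩ else if h' : i < j then v ⟨j, h'⟩ else x

/-- A finite product of probability distributions has total mass `1`. -/
theorem hasSum_pi_prod_one {Y : Type u} : ∀ (n : ℕ) (p : Fin n → Y → ℝ),
    (∀ i y, 0 ≤ p i y) → (∀ i, HasSum (p i) 1) →
      HasSum (fun y : Fin n → Y => ∏ i, p i (y i)) 1 := by
  intro n
  induction n with
  | zero =>
    intro p _ _
    simp
  | succ n ih =>
    intro p h0 h1
    have h2 := ih (fun i => p i.succ) (fun i => h0 i.succ) (fun i => h1 i.succ)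
    set F : (Fin n → Y) → ℝ := fun z => ∏ i : Fin n, p i.succ (z i) with hF
    have hF0 : ∀ z, 0 ≤ F z := fun z => Finset.prod_nonneg fun i _ => h0 _ _
    have hs : Summable fun z : Y × (Fin n → Y) => p 0 z.1 * F z.2 :=
      Summable.mul_of_nonneg (h1 0).summable h2.summable (h0 0) hF0
    have h3 : HasSum (fun z : Y × (Fin n → Y) => p 0 z.1 * F z.2) (1 * 1) := (h1 0).mul h2 hs
    rw [one_mul] at h3
    refine (Equiv.hasSum_iff (Fin.consEquiv (fun _ : Fin (n + 1) => Y))).1 ?_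
    refine h3.congr_fun ?_
    intro z
    simp [Fin.consEquiv, Fin.prod_univ_succ, hF]

/-- The transition probabilities of a subchannel sum to `1`. -/
theorem subchannel_hasSum {X : Type u} [Fintype X] [Nonempty X] {ℓ : ℕ} (W : DMC X)
    (g : Equiv.Perm (Fin ℓ → X)) (i : Fin ℓ) (x : X) :
    HasSum (fun z : (Fin ℓ → W.Out) × ({j : Fin ℓ // j < i} → X) =>
      1 / (Fintype.card X : ℝ) ^ (ℓ - 1) *
        ∑ v : {j : Fin ℓ // i < j} → X, ∏ j, W.prob (g (joinVec i z.2 x v) j) (z.1 j)) 1 := by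
  have hq : (Fintype.card X : ℝ) ≠ 0 := by exact_mod_cast Fintype.card_ne_zero
  let F : ({j : Fin ℓ // j < i} → X) → (Fin ℓ → W.Out) → ℝ := fun u y =>
    1 / (Fintype.card X : ℝ) ^ (ℓ - 1) *
      ∑ v : {j : Fin ℓ // i < j} → X, ∏ j, W.prob (g (joinVec i u x v) j) (y j)
  have hF0 : ∀ u y, 0 ≤ F u y := fun u y => mul_nonneg (by positivity)
    (Finset.sum_nonneg fun v _ => Finset.prod_nonneg fun j _ => W.prob_nonneg _ _)
  have hu : ∀ u, HasSum (F u)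
      (1 / (Fintype.card X : ℝ) ^ (ℓ - 1) * ∑ _v : {j : Fin ℓ // i < j} → X, (1 : ℝ)) := by
    intro u
    refine HasSum.mul_left _ (hasSum_sum fun v _ => ?_)
    exact hasSum_pi_prod_one ℓ (fun j => W.prob (g (joinVec i u x v) j))
      (fun j y => W.prob_nonneg _ y) (fun j => W.prob_hasSum _)
  have hs : Summable fun z : ({j : Fin ℓ // j < i} → X) × (Fin ℓ → W.Out) => F z.1 z.2 := by
    refine (summable_prod_of_nonneg (fun z => hF0 z.1 z.2)).2 ⟨fun u => (hu u).summable, ?_⟩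
    exact (hasSum_fintype _).summable
  have h2 := (hs.hasSum.prod_fiberwise hu).unique (hasSum_fintype _)
  have hc : (i : ℕ) + (ℓ - 1 - i) = ℓ - 1 := by have := i.2; omega
  have ha : Fintype.card {j : Fin ℓ // j < i} = (i : ℕ) := by
    rw [Fintype.card_subtype, ← Fin.card_Iio i]
    congr 1; ext j; simp
  have hb : Fintype.card {j : Fin ℓ // i < j} = ℓ - 1 - (i : ℕ) := by
    rw [Fintype.card_subtype, ← Fin.card_Ioi i]
    congr 1; ext j; simp
  have h3 : (∑ _u : {j : Fin ℓ // j < i} → X, 1 / (Fintype.card X : ℝ) ^ (ℓ - 1) *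
      ∑ _v : {j : Fin ℓ // i < j} → X, (1 : ℝ)) = 1 := by
    simp only [Finset.sum_const, Finset.card_univ, nsmul_eq_mul, mul_one, Fintype.card_fun, ha, hb]
    push_cast
    have h5 : (Fintype.card X : ℝ) ^ (ℓ - 1) =
        (Fintype.card X : ℝ) ^ (i : ℕ) * (Fintype.card X : ℝ) ^ (ℓ - 1 - (i : ℕ)) := by
      rw [← pow_add, hc]
    rw [h5]
    field_simp
  have h4 := hs.hasSum
  rw [h2, h3] at h4
  exact (Equiv.hasSum_iff (Equiv.prodComm ({j : Fin ℓ // j < i} → X) (Fin ℓ → W.Out))).1 h4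

noncomputable section

namespace DMC

variable {X : Type u} [Fintype X]

/-- The symmetric capacity `I(W)`, with logarithms to base `q = |X|` (and `0 log 0 = 0`). -/
def capacity (W : DMC X) : ℝ :=
  ∑ x, ∑' y, 1 / (Fintype.card X : ℝ) * W.prob x y *
    Real.logb (Fintype.card X)
      (W.prob x y / (1 / (Fintype.card X : ℝ) * ∑ x', W.prob x' y))

/-- The Bhattacharyya parameter `Z_{x,x'}(W)` between two inputs. -/
def bhatt (W : DMC X) (x x' : X) : ℝ := ∑' y, √(W.prob x y * W.prob x' y)

/-- The Bhattacharyya parameter `Z(W)`: the average of `Z_{x,x'}(W)` over pairs `x ≠ x'`. -/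
def Z [DecidableEq X] (W : DMC X) : ℝ :=
  1 / ((Fintype.card X : ℝ) * ((Fintype.card X : ℝ) - 1)) *
    ∑ p : X × X with p.1 ≠ p.2, W.bhatt p.1 p.2

/-- `Z_min(W)`, the minimum of `Z_{x,x'}(W)` over all pairs of inputs. -/
def Zmin (W : DMC X) : ℝ := ⨅ p : X × X, W.bhatt p.1 p.2

/-- The subchannel `W^{(i)} : X → Y^ℓ × X^i` of `W` under the kernel `g`:
`W^{(i)}(y, u ∣ x) = q^{-(ℓ-1)} ∑_v W^ℓ(y ∣ g(u, x, v))`. -/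
def sub [Nonempty X] {ℓ : ℕ} (W : DMC X) (g : Equiv.Perm (Fin ℓ → X)) (i : Fin ℓ) : DMC X where
  Out := (Fin ℓ → W.Out) × ({j : Fin ℓ // j < i} → X)
  countable_out := by
    have := W.countable_out
    infer_instance
  prob x z := 1 / (Fintype.card X : ℝ) ^ (ℓ - 1) *
    ∑ v : {j : Fin ℓ // i < j} → X, ∏ j, W.prob (g (joinVec i z.2 x v) j) (z.1 j)
  prob_nonneg x z := mul_nonneg (by positivity) (Finset.sum_nonneg fun v _ =>
    Finset.prod_nonneg fun j _ => W.prob_nonneg _ _)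
  prob_hasSum x := subchannel_hasSum W g i x

/-- The iterated subchannel `W^{(b_0)(b_1)⋯(b_{n-1})}`. -/
def iter [Nonempty X] {ℓ : ℕ} (W : DMC X) (g : Equiv.Perm (Fin ℓ → X)) (b : ℕ → Fin ℓ) :
    ℕ → DMC X
  | 0 => W
  | n + 1 => (iter W g b n).sub g (b n)

/-- `I_∞`, the limit of the symmetric capacities `I(W^{(b_0)⋯(b_{n-1})})` as `n → ∞`. -/
def Iinf [Nonempty X] {ℓ : ℕ} (W : DMC X) (g : Equiv.Perm (Fin ℓ → X)) (b : ℕ → Fin ℓ) : ℝ :=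
  limUnder atTop fun n => (W.iter g b n).capacity

end DMC

namespace PolarKernel

variable {X : Type u} [Fintype X] [DecidableEq X] {ℓ : ℕ}

/-- The partial distance `D_{x,x'}^{[i]}(u_0, …, u_{i-1})` of the kernel `g`. -/
def partialDistAt (g : Equiv.Perm (Fin ℓ → X)) (i : Fin ℓ) (u : {j : Fin ℓ // j < i} → X)
    (x x' : X) : ℕ :=
  ⨅ p : ({j : Fin ℓ // i < j} → X) × ({j : Fin ℓ // i < j} → X),
    hammingDist (g (joinVec i u x p.1)) (g (joinVec i u x' p.2))

/-- The partial distance `D_{x,x'}^{[i]}`, the minimum over all prefixes. -/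
def partialDist (g : Equiv.Perm (Fin ℓ → X)) (i : Fin ℓ) (x x' : X) : ℕ :=
  ⨅ u : {j : Fin ℓ // j < i} → X, partialDistAt g i u x x'

/-- `D_max^{[i]}`, the maximum of `D_{x,x'}^{[i]}` over all pairs of inputs. -/
def Dmax (g : Equiv.Perm (Fin ℓ → X)) (i : Fin ℓ) : ℕ :=
  ⨆ p : X × X, partialDist g i p.1 p.2

/-- `D_min^{[i]}`, the minimum of `D_{x,x'}^{[i]}` over pairs of distinct inputs. -/
def Dmin (g : Equiv.Perm (Fin ℓ → X)) (i : Fin ℓ) : ℕ :=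
  ⨅ p : {p : X × X // p.1 ≠ p.2}, partialDist g i p.1.1 p.1.2

/-- The mean of `log_ℓ D_i` for `i` uniform on `{0, …, ℓ-1}`. -/
def logMean (D : Fin ℓ → ℕ) : ℝ := 1 / (ℓ : ℝ) * ∑ i, Real.logb ℓ (D i)

/-- The variance of `log_ℓ D_i` for `i` uniform on `{0, …, ℓ-1}`. -/
def logVar (D : Fin ℓ → ℕ) : ℝ :=
  1 / (ℓ : ℝ) * ∑ i, (Real.logb ℓ (D i) - logMean D) ^ 2

def E₁ (g : Equiv.Perm (Fin ℓ → X)) : ℝ := logMean (Dmin g)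

def V₁ (g : Equiv.Perm (Fin ℓ → X)) : ℝ := logVar (Dmin g)

def E₂ (g : Equiv.Perm (Fin ℓ → X)) : ℝ := logMean (Dmax g)

def V₂ (g : Equiv.Perm (Fin ℓ → X)) : ℝ := logVar (Dmax g)

end PolarKernel

/-- The Gaussian tail `Q(t)`. -/
def gaussQ (t : ℝ) : ℝ :=
  1 / √(2 * Real.pi) * ∫ x in Set.Ioi t, Real.exp (-(x ^ 2 / 2))

end

/-! The proof runs on two time scales: a fixed initial time `m` decides whether the channel becomes
good, and the later steps decide how fast.

Good or bad. The chain rule for entropy, with the bijectivity of the kernel, shows that the average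
of the capacities of the subchannels is the capacity of the channel (`sum_capacity_sub`). Hence the
capacities along a random path form a bounded martingale. Its limit lies in {0,1} and has mean I(W),
so the probability that I(W_n) > a tends to I(W) for every a in (0,1). Inequalities between entropy
and Bhattacharyya parameters say that capacity near 1 forces every off-diagonal parameter to be
small, and that small Z forces capacity above 1/2.

Speed. One step with index i takes a bound z on the parameters to at most q^ℓ z^(D_min) from above
(`bhatt_sub_le`) and to at least q^(-ℓ) z^(D_max) from below (`le_bhatt_sub`). For the exponent
-log₂ z this is multiplication by a distance up to an additive constant c = ℓ log₂ q. The logarithm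
of the product of the distances is a sum of i.i.d. terms, to which the central limit theorem
applies; a fixed initial segment and an o(√n) shift do not matter (`tendsto_real_lt_sum`).

Lower bound. If the exponent at time m is at least K, then at time n it is at least P (K - c R),
with P the product of the distances since m and R the sum of the inverses of its partial products. A
positive variance makes some distance exceed 1, so the mean of 1/D is below 1 and R has mean bounded
by a geometric series, uniformly in n. By Markov's inequality a large K gives K - c R > 1 outside a
small event, and the exponent then exceeds P. What happens before m is independent of P and R.

Upper bound. Starting from Z_min(W) > 0, the exponent at time n is at most the full product times y
+ n c, and the extra factor costs only O(log n) after taking logarithms. To gain the factor I(W),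
note that small Z(W_n) forces I(W_n) > 1/2, which up to small probability forces I(W_m) > 1/2; this
last event is independent of the steps after m. -/

noncomputable section

/-! ### Entropy of unnormalized weights -/

/-- For nonnegative weights `a` of total mass `s`, this is `s` times the Shannon entropy (in nats)
of the normalized weights. -/
def entropyGap {ι : Type*} [Fintype ι] (a : ι → ℝ) : ℝ :=
  ∑ x, Real.negMulLog (a x) - Real.negMulLog (∑ x, a x)

section EntropyGap

variable {ι : Type*} [Fintype ι]

theorem entropyGap_comp_equiv (e : Equiv.Perm ι) (a : ι → ℝ) :
    entropyGap (fun x => a (e x)) = entropyGap a := by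
  unfold entropyGap
  rw [Equiv.sum_comp e a, Equiv.sum_comp e (fun x => Real.negMulLog (a x))]

theorem entropyGap_eq_sum (a : ι → ℝ) :
    entropyGap a = ∑ x, a x * (Real.log (∑ x', a x') - Real.log (a x)) := by
  simp only [entropyGap, Real.negMulLog, mul_sub, Finset.sum_sub_distrib, ← Finset.sum_mul,
    Finset.sum_neg_distrib, neg_mul]
  ring

theorem entropyGap_term_nonneg {a : ι → ℝ} (ha : ∀ x, 0 ≤ a x) (x : ι) :
    0 ≤ a x * (Real.log (∑ x', a x') - Real.log (a x)) := by
  rcases (ha x).eq_or_lt with h | h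
  · simp [← h]
  · exact mul_nonneg h.le (sub_nonneg.2 (Real.log_le_log h
      (Finset.single_le_sum (fun i _ => ha i) (Finset.mem_univ x))))

theorem entropyGap_nonneg {a : ι → ℝ} (ha : ∀ x, 0 ≤ a x) : 0 ≤ entropyGap a := by
  rw [entropyGap_eq_sum]
  exact Finset.sum_nonneg fun x _ => entropyGap_term_nonneg ha x

/-- This is log r ≤ r - 1 at r = s/(a q). Summed over q weights of total s, the right side vanishes,
which gives the maximum-entropy bound. -/
theorem mul_log_sub_le {q a s : ℝ} (hq : 0 < q) (ha : 0 ≤ a) (hs : a ≤ s) :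
    a * (Real.log s - Real.log a - Real.log q) ≤ s / q - a := by
  rcases ha.eq_or_lt with h | h
  · rw [← h]; simp; exact div_nonneg (h ▸ hs) hq.le
  · have hs0 : 0 < s := h.trans_le hs
    have h1 := Real.log_le_sub_one_of_pos (show 0 < s / a / q by positivity)
    rw [Real.log_div (by positivity) hq.ne', Real.log_div hs0.ne' h.ne'] at h1
    calc _ ≤ a * (s / a / q - 1) := mul_le_mul_of_nonneg_left h1 h.le
      _ = _ := by field_simp

theorem entropyGap_le [Nonempty ι] {a : ι → ℝ} (ha : ∀ x, 0 ≤ a x) :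
    entropyGap a ≤ (∑ x, a x) * Real.log (Fintype.card ι) := by
  rw [entropyGap_eq_sum, ← sub_nonpos, Finset.sum_mul, ← Finset.sum_sub_distrib]
  have hq : (0 : ℝ) < Fintype.card ι := by exact_mod_cast Fintype.card_pos
  calc _ ≤ ∑ x, ((∑ x', a x') / (Fintype.card ι : ℝ) - a x) := by
        refine Finset.sum_le_sum fun x _ => ?_
        rw [← mul_sub]
        exact mul_log_sub_le hq (ha x) (Finset.single_le_sum (fun i _ => ha i) (Finset.mem_univ x))
    _ = 0 := by
        rw [Finset.sum_sub_distrib, Finset.sum_const, Finset.card_univ, nsmul_eq_mul]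
        field_simp
        simp

/-- `Real.negMulLog` obeys the Leibniz rule on products, so induction on the set of factors gives
the rule for many factors. -/
theorem negMulLog_prod {κ : Type*} [DecidableEq κ] (s : Finset κ) (f : κ → ℝ) :
    Real.negMulLog (∏ j ∈ s, f j) =
      ∑ j ∈ s, ∏ k ∈ s, if k = j then Real.negMulLog (f k) else f k := by
  induction s using Finset.induction_on with
  | empty => simp
  | insert i s hi ih =>
    rw [Finset.prod_insert hi, Real.negMulLog_mul, ih, Finset.sum_insert hi,
      Finset.prod_insert hi, if_pos rfl, Finset.mul_sum]
    congr 1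
    · rw [mul_comm]
      congr 1
      exact Finset.prod_congr rfl fun k hk => by rw [if_neg (by rintro rfl; exact hi hk)]
    · refine Finset.sum_congr rfl fun j hj => ?_
      rw [Finset.prod_insert hi, if_neg (by rintro rfl; exact hi hj)]

/-- Additivity of entropy over independent coordinates. Since the weights are not normalized, each
summand carries the total masses of the other coordinates. -/
theorem entropyGap_pi_prod [DecidableEq ι] {n : ℕ} (a : Fin n → ι → ℝ) :
    entropyGap (fun w : Fin n → ι => ∏ j, a j (w j)) =
      ∑ j, ∏ k, if k = j then entropyGap (a k) else ∑ x, a k x := by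
  have h1 : ∀ b : Fin n → ι → ℝ, ∑ w : Fin n → ι, ∏ j, b j (w j) = ∏ j, ∑ x, b j x := by
    intro b
    rw [Finset.prod_univ_sum, Fintype.piFinset_univ]
  unfold entropyGap
  rw [h1, negMulLog_prod]
  simp only [negMulLog_prod]
  rw [Finset.sum_comm, ← Finset.sum_sub_distrib]
  refine Finset.sum_congr rfl fun j _ => ?_
  have h2 := h1 (fun k x => if k = j then Real.negMulLog (a k x) else a k x)
  rw [h2]
  rw [← Finset.mul_prod_erase _ _ (Finset.mem_univ j),
    ← Finset.mul_prod_erase _ _ (Finset.mem_univ j),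
    ← Finset.mul_prod_erase _ _ (Finset.mem_univ j)]
  have h3 : ∀ (F G : Fin n → ℝ), ∏ k ∈ Finset.univ.erase j, (if k = j then F k else G k) =
      ∏ k ∈ Finset.univ.erase j, G k := fun F G =>
    Finset.prod_congr rfl fun k hk => if_neg (Finset.ne_of_mem_erase hk)
  have h4 : ∏ k ∈ Finset.univ.erase j,
      ∑ x, (if k = j then Real.negMulLog (a k x) else a k x) =
      ∏ k ∈ Finset.univ.erase j, ∑ x, a k x :=
    Finset.prod_congr rfl fun k hk => by simp only [if_neg (Finset.ne_of_mem_erase hk)]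
  rw [h3, h3, h4]
  simp only [if_true]
  ring

end EntropyGap

/-! ### Splitting vectors at a position and the chain rule -/

section JoinVec

variable {X : Type u} {ℓ : ℕ}

/-- Splitting a vector at position `i`. -/
def joinEquiv (i : Fin ℓ) :
    ({j : Fin ℓ // j < i} → X) × X × ({j : Fin ℓ // i < j} → X) ≃ (Fin ℓ → X) where
  toFun p := joinVec i p.1 p.2.1 p.2.2
  invFun w := (fun j => w j, w i, fun j => w j)
  left_inv p := by
    obtain ⟨u, x, v⟩ := p
    refine Prod.ext (funext fun j => ?_) (Prod.ext ?_ (funext fun j => ?_))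
    · simp [joinVec, j.2]
    · simp [joinVec]
    · simp [joinVec, j.2, not_lt_of_gt j.2]
  right_inv w := by
    funext j
    simp only [joinVec]
    split_ifs with h1 h2
    · rfl
    · rfl
    · rw [le_antisymm (not_lt.1 h2) (not_lt.1 h1)]

@[simp] theorem joinVec_self (i : Fin ℓ) (u : {j : Fin ℓ // j < i} → X) (x : X)
    (v : {j : Fin ℓ // i < j} → X) : joinVec i u x v i = x := by simp [joinVec]

theorem joinVec_of_lt {i j : Fin ℓ} (h : j < i) (u : {j : Fin ℓ // j < i} → X) (x : X)
    (v : {j : Fin ℓ // i < j} → X) : joinVec i u x v j = u ⟨j, h⟩ := by simp [joinVec, h]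

variable [Fintype X]

theorem sum_joinVec (i : Fin ℓ) (a : (Fin ℓ → X) → ℝ) :
    ∑ w, a w = ∑ u, ∑ x, ∑ v, a (joinVec i u x v) := by
  rw [← Equiv.sum_comp (joinEquiv i), Fintype.sum_prod_type]
  simp only [Fintype.sum_prod_type]
  rfl

open Classical in
/-- The total weight of the vectors that agree with `w` in the first `k` positions. -/
def prefixWeight (a : (Fin ℓ → X) → ℝ) (k : ℕ) (w : Fin ℓ → X) : ℝ :=
  ∑ w', if ∀ j : Fin ℓ, (j : ℕ) < k → w' j = w j then a w' else 0

theorem prefixWeight_joinVec (a : (Fin ℓ → X) → ℝ) (i : Fin ℓ) (u : {j : Fin ℓ // j < i} → X)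
    (x : X) (v : {j : Fin ℓ // i < j} → X) :
    prefixWeight a i (joinVec i u x v) = ∑ x', ∑ v', a (joinVec i u x' v') := by
  classical
  unfold prefixWeight
  rw [sum_joinVec i, Finset.sum_eq_single u]
  · refine Finset.sum_congr rfl fun x' _ => Finset.sum_congr rfl fun v' _ => if_pos fun j hj => ?_
    rw [joinVec_of_lt hj, joinVec_of_lt hj]
  · intro u' _ hu
    refine Finset.sum_eq_zero fun x' _ => Finset.sum_eq_zero fun v' _ => if_neg fun h => hu ?_
    funext j
    have := h j j.2
    rwa [joinVec_of_lt j.2, joinVec_of_lt j.2] at this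
  · simp

theorem prefixWeight_succ_joinVec (a : (Fin ℓ → X) → ℝ) (i : Fin ℓ)
    (u : {j : Fin ℓ // j < i} → X) (x : X) (v : {j : Fin ℓ // i < j} → X) :
    prefixWeight a (i + 1) (joinVec i u x v) = ∑ v', a (joinVec i u x v') := by
  classical
  unfold prefixWeight
  rw [sum_joinVec i, Finset.sum_eq_single u, Finset.sum_eq_single x]
  · refine Finset.sum_congr rfl fun v' _ => if_pos fun j hj => ?_
    rcases (Nat.lt_succ_iff.1 hj).lt_or_eq with h | h
    · rw [joinVec_of_lt h, joinVec_of_lt h]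
    · rw [Fin.ext h, joinVec_self, joinVec_self]
  · intro x' _ hx
    refine Finset.sum_eq_zero fun v' _ => if_neg fun h => hx ?_
    have := h i (Nat.lt_succ_self _)
    rwa [joinVec_self, joinVec_self] at this
  · simp
  · intro u' _ hu
    refine Finset.sum_eq_zero fun x' _ => Finset.sum_eq_zero fun v' _ => if_neg fun h => hu ?_
    funext j
    have := h j (Nat.lt_succ_of_lt j.2)
    rwa [joinVec_of_lt j.2, joinVec_of_lt j.2] at this
  · simp

/-- The chain rule for the entropy of a vector. -/
theorem sum_entropyGap_joinVec (a : (Fin ℓ → X) → ℝ) :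
    ∑ i : Fin ℓ, ∑ u, entropyGap (fun x => ∑ v, a (joinVec i u x v)) = entropyGap a := by
  classical
  -- The entropy contributed by position `i` is `L i - L (i + 1)`, so the sum telescopes. The prefix
  -- of length 0 has the total mass as its weight, and the prefix of length `ℓ` determines the
  -- vector.
  set L : ℕ → ℝ := fun k => ∑ w, a w * Real.log (prefixWeight a k w) with hL
  have h1 : ∀ i : Fin ℓ, ∑ u, entropyGap (fun x => ∑ v, a (joinVec i u x v)) =
      L i - L (i + 1) := by
    intro i
    simp only [hL]
    rw [sum_joinVec i, sum_joinVec i, ← Finset.sum_sub_distrib]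
    refine Finset.sum_congr rfl fun u _ => ?_
    simp only [prefixWeight_joinVec, prefixWeight_succ_joinVec, entropyGap_eq_sum,
      ← Finset.sum_mul, mul_sub, Finset.sum_sub_distrib]
  simp only [h1]
  rw [Fin.sum_univ_eq_sum_range (fun i => L i - L (i + 1)), Finset.sum_range_sub',
    entropyGap_eq_sum]
  have h0 : ∀ w, prefixWeight a 0 w = ∑ w', a w' := fun w => by simp [prefixWeight]
  have hl : ∀ w, prefixWeight a ℓ w = a w := by
    intro w
    have : ∀ w' : Fin ℓ → X, (∀ j : Fin ℓ, (j : ℕ) < ℓ → w' j = w j) ↔ w' = w :=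
      fun w' => ⟨fun h => funext fun j => h j j.2, fun h => by simp [h]⟩
    simp only [prefixWeight, this]
    simp
  simp only [hL, h0, hl, mul_sub, Finset.sum_sub_distrib]

end JoinVec

/-! ### Capacity through conditional entropy, and its conservation -/

theorem hasSum_pi_prod {Y : Type u} : ∀ (n : ℕ) (p : Fin n → Y → ℝ) (s : Fin n → ℝ),
    (∀ i, HasSum (p i) (s i)) → HasSum (fun y : Fin n → Y => ∏ i, p i (y i)) (∏ i, s i) := by
  intro n
  induction n with
  | zero =>
    intro p s _
    simp
  | succ n ih =>
    intro p s h1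
    have h2 := ih (fun i => p i.succ) (fun i => s i.succ) (fun i => h1 i.succ)
    set F : (Fin n → Y) → ℝ := fun z => ∏ i : Fin n, p i.succ (z i) with hF
    -- Summability of real series is absolute, so no sign condition on the factors is needed.
    have hs : Summable fun z : Y × (Fin n → Y) => p 0 z.1 * F z.2 :=
      summable_mul_of_summable_norm (h1 0).summable.norm h2.summable.norm
    have h3 := (h1 0).mul h2 hs
    rw [Fin.prod_univ_succ]
    refine (Equiv.hasSum_iff (Fin.consEquiv (fun _ : Fin (n + 1) => Y))).1 ?_
    refine h3.congr_fun ?_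
    intro z
    simp [Fin.consEquiv, Fin.prod_univ_succ, hF]

namespace DMC

variable {X : Type u} [Fintype X]

/-- The conditional entropy (in nats) of a uniform input given the output. -/
def condEnt (W : DMC X) : ℝ :=
  ∑' y, entropyGap (fun x => 1 / (Fintype.card X : ℝ) * W.prob x y)

theorem hasSum_avg [Nonempty X] (W : DMC X) :
    HasSum (fun y => ∑ x, 1 / (Fintype.card X : ℝ) * W.prob x y) 1 := by
  have h := hasSum_sum (s := Finset.univ)
    (fun x (_ : x ∈ Finset.univ) => (W.prob_hasSum x).mul_left (1 / (Fintype.card X : ℝ)))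
  have hq : (Fintype.card X : ℝ) ≠ 0 := by exact_mod_cast Fintype.card_ne_zero
  simpa [hq] using h

theorem weight_nonneg (W : DMC X) (x : X) (y : W.Out) :
    0 ≤ 1 / (Fintype.card X : ℝ) * W.prob x y :=
  mul_nonneg (by positivity) (W.prob_nonneg x y)

theorem summable_entropyGap [Nonempty X] (W : DMC X) :
    Summable fun y => entropyGap (fun x => 1 / (Fintype.card X : ℝ) * W.prob x y) :=
  Summable.of_nonneg_of_le (fun y => entropyGap_nonneg fun x => W.weight_nonneg x y)
    (fun y => entropyGap_le fun x => W.weight_nonneg x y)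
    (W.hasSum_avg.summable.mul_right _)

theorem condEnt_nonneg (W : DMC X) : 0 ≤ W.condEnt :=
  tsum_nonneg fun y => entropyGap_nonneg fun x => W.weight_nonneg x y

theorem condEnt_le [Nonempty X] (W : DMC X) : W.condEnt ≤ Real.log (Fintype.card X) := by
  have h := W.summable_entropyGap.tsum_le_tsum
    (fun y => entropyGap_le fun x => W.weight_nonneg x y) (W.hasSum_avg.summable.mul_right _)
  rwa [(W.hasSum_avg.mul_right _).tsum_eq, one_mul] at h

/-- A summable dominating function for each capacity term, which permits exchanging the sum over
inputs with the series over outputs. -/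
theorem abs_mul_log_le {q a s : ℝ} (hq : 1 ≤ q) (ha : 0 ≤ a) (hs : a ≤ s) :
    |a * Real.log (q * a / s)| ≤ a * Real.log q + s := by
  have hlq := Real.log_nonneg hq
  rcases ha.eq_or_lt with h | h
  · subst h
    simpa using hs
  · have hs0 : 0 < s := h.trans_le hs
    have h1 := mul_log_sub_le (zero_lt_one.trans_le hq) ha hs
    have h2 : s / q ≤ s := div_le_self hs0.le hq
    have h3 : a * (Real.log a - Real.log s) ≤ 0 :=
      mul_nonpos_of_nonneg_of_nonpos ha (sub_nonpos.2 (Real.log_le_log h hs))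
    have h4 : 0 ≤ a * Real.log q := mul_nonneg ha hlq
    rw [Real.log_div (by positivity) hs0.ne', Real.log_mul (by positivity) h.ne', abs_le]
    constructor <;> nlinarith

theorem capacity_eq [Nontrivial X] (W : DMC X) :
    W.capacity = 1 - W.condEnt / Real.log (Fintype.card X) := by
  set q : ℝ := (Fintype.card X : ℝ) with hq
  have hq1 : 1 < q := by rw [hq]; exact_mod_cast Fintype.one_lt_card
  have hl : 0 < Real.log q := Real.log_pos hq1
  set a : X → W.Out → ℝ := fun x y => 1 / q * W.prob x y with ha
  have ha0 : ∀ x y, 0 ≤ a x y := W.weight_nonneg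
  have hle : ∀ x y, a x y ≤ ∑ x', a x' y := fun x y =>
    Finset.single_le_sum (fun i _ => ha0 i y) (Finset.mem_univ x)
  have hterm : ∀ x y, 1 / q * W.prob x y *
      Real.logb q (W.prob x y / (1 / q * ∑ x', W.prob x' y)) =
      a x y * Real.log (q * a x y / ∑ x', a x' y) / Real.log q := by
    intro x y
    simp only [ha, ← Finset.mul_sum, Real.logb]
    rw [← mul_assoc q, mul_one_div_cancel (by positivity), one_mul, mul_div_assoc]
  have hsum : ∀ x, Summable fun y => a x y * Real.log (q * a x y / ∑ x', a x' y) := by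
    intro x
    refine Summable.of_norm_bounded (g := fun y => a x y * Real.log q + ∑ x', a x' y) ?_
      fun y => abs_mul_log_le hq1.le (ha0 x y) (hle x y)
    exact (((W.prob_hasSum x).summable.mul_left _).mul_right _).add W.hasSum_avg.summable
  have hpt : ∀ y, ∑ x, a x y * Real.log (q * a x y / ∑ x', a x' y) =
      (∑ x, a x y) * Real.log q - entropyGap (fun x => a x y) := by
    intro y
    rw [entropyGap_eq_sum, Finset.sum_mul, ← Finset.sum_sub_distrib]
    refine Finset.sum_congr rfl fun x _ => ?_
    rcases (ha0 x y).eq_or_lt with h | h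
    · simp [← h]
    · rw [Real.log_div (by positivity) (h.trans_le (hle x y)).ne',
        Real.log_mul (by positivity) h.ne']
      ring
  unfold capacity
  simp only [← hq, hterm]
  rw [← Summable.tsum_finsetSum fun x _ => (hsum x).div_const _]
  simp only [← Finset.sum_div, hpt]
  rw [tsum_div_const, Summable.tsum_sub (W.hasSum_avg.summable.mul_right _) W.summable_entropyGap,
    (W.hasSum_avg.mul_right _).tsum_eq, one_mul, sub_div, div_self hl.ne']
  rfl

theorem capacity_le_one [Nontrivial X] (W : DMC X) : W.capacity ≤ 1 := by
  rw [capacity_eq, sub_le_self_iff]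
  exact div_nonneg W.condEnt_nonneg (Real.log_natCast_nonneg _)

theorem capacity_nonneg [Nontrivial X] (W : DMC X) : 0 ≤ W.capacity := by
  have hl : 0 < Real.log (Fintype.card X) :=
    Real.log_pos (by exact_mod_cast Fintype.one_lt_card)
  rw [capacity_eq, sub_nonneg, div_le_one hl]
  exact W.condEnt_le

variable {ℓ : ℕ}

/-- For a fixed output vector y, the subchannels see successive conditional entropies of one weight
on input vectors. The chain rule adds them up, the bijection `g` only permutes the input vectors,
and what remains is a product weight, whose entropy is additive. -/
theorem sum_condEnt_sub [Nonempty X] (W : DMC X) (g : Equiv.Perm (Fin ℓ → X)) :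
    ∑ i, (W.sub g i).condEnt = ℓ * W.condEnt := by
  classical
  have hq : (Fintype.card X : ℝ) ≠ 0 := by exact_mod_cast Fintype.card_ne_zero
  set a : (Fin ℓ → W.Out) → (Fin ℓ → X) → ℝ :=
    fun y w => ∏ j, (1 / (Fintype.card X : ℝ) * W.prob (w j) (y j)) with ha
  have hterm : ∀ (i : Fin ℓ) (y : Fin ℓ → W.Out) (u : {j : Fin ℓ // j < i} → X),
      entropyGap (fun x => 1 / (Fintype.card X : ℝ) * (W.sub g i).prob x (y, u)) =
      entropyGap (fun x => ∑ v, a y (g (joinVec i u x v))) := by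
    intro i y u
    congr 1
    funext x
    -- The factor 1/q of the uniform input completes q^(-(ℓ-1)) to q^(-ℓ), that is, one factor 1/q
    -- for each coordinate.
    simp only [ha, sub, Finset.prod_mul_distrib, Finset.prod_const, Finset.card_univ,
      Fintype.card_fin, ← Finset.mul_sum, ← mul_assoc]
    congr 1
    rw [one_div, one_div, ← mul_inv, ← pow_succ', inv_pow]
    congr 2
    have := i.2
    omega
  have hsumm : ∀ i, Summable fun z : (Fin ℓ → W.Out) × ({j : Fin ℓ // j < i} → X) =>
      entropyGap (fun x => ∑ v, a z.1 (g (joinVec i z.2 x v))) := fun i =>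
    (W.sub g i).summable_entropyGap.congr fun z => hterm i z.1 z.2
  have h1 : ∀ i, (W.sub g i).condEnt =
      ∑' y, ∑ u, entropyGap (fun x => ∑ v, a y (g (joinVec i u x v))) := by
    intro i
    unfold condEnt
    rw [show (∑' z, entropyGap (fun x => 1 / (Fintype.card X : ℝ) * (W.sub g i).prob x z)) =
      ∑' z : (Fin ℓ → W.Out) × ({j : Fin ℓ // j < i} → X),
        entropyGap (fun x => ∑ v, a z.1 (g (joinVec i z.2 x v))) from
        tsum_congr fun z => hterm i z.1 z.2, (hsumm i).tsum_prod]
    exact tsum_congr fun y => tsum_fintype _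
  have h2 : ∀ i, Summable fun y => ∑ u, entropyGap (fun x => ∑ v, a y (g (joinVec i u x v))) := by
    intro i
    refine (hsumm i).prod.congr fun y => ?_
    exact (tsum_fintype _)
  simp only [h1]
  rw [← Summable.tsum_finsetSum fun i _ => h2 i]
  have h3 : ∀ y, ∑ i : Fin ℓ, ∑ u, entropyGap (fun x => ∑ v, a y (g (joinVec i u x v))) =
      ∑ j, ∏ k, if k = j then entropyGap (fun x => 1 / (Fintype.card X : ℝ) * W.prob x (y k))
        else ∑ x, 1 / (Fintype.card X : ℝ) * W.prob x (y k) := by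
    intro y
    rw [sum_entropyGap_joinVec (fun w => a y (g w)), entropyGap_comp_equiv g]
    exact entropyGap_pi_prod (fun j x => 1 / (Fintype.card X : ℝ) * W.prob x (y j))
  simp only [h3]
  have h4 : ∀ j : Fin ℓ, HasSum (fun y : Fin ℓ → W.Out => ∏ k, if k = j then
      entropyGap (fun x => 1 / (Fintype.card X : ℝ) * W.prob x (y k))
        else ∑ x, 1 / (Fintype.card X : ℝ) * W.prob x (y k))
      (∏ k, if k = j then W.condEnt else 1) := by
    intro j
    refine hasSum_pi_prod ℓ (fun k y => if k = j then
      entropyGap (fun x => 1 / (Fintype.card X : ℝ) * W.prob x y)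
        else ∑ x, 1 / (Fintype.card X : ℝ) * W.prob x y) _ fun k => ?_
    by_cases h : k = j
    · simp only [h, if_true]
      exact W.summable_entropyGap.hasSum
    · simp only [h, if_false]
      exact W.hasSum_avg
  rw [(hasSum_sum fun j _ => h4 j).tsum_eq]
  simp

theorem sum_capacity_sub [Nontrivial X] (W : DMC X) (g : Equiv.Perm (Fin ℓ → X)) :
    ∑ i, (W.sub g i).capacity = ℓ * W.capacity := by
  simp only [capacity_eq, Finset.sum_sub_distrib, ← Finset.sum_div, sum_condEnt_sub]
  simp
  ring

end DMC

/-! ### Partial distances of the kernel -/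

namespace PolarKernel

variable {X : Type u} [Fintype X] [DecidableEq X] {ℓ : ℕ}

omit [Fintype X] in
theorem hammingDist_joinVec_pos (g : Equiv.Perm (Fin ℓ → X)) (i : Fin ℓ)
    (u : {j : Fin ℓ // j < i} → X) {x x' : X} (h : x ≠ x') (v w : {j : Fin ℓ // i < j} → X) :
    0 < hammingDist (g (joinVec i u x v)) (g (joinVec i u x' w)) := by
  rw [hammingDist_pos]
  intro he
  have := congrFun (g.injective he) i
  rw [joinVec_self, joinVec_self] at this
  exact h this

theorem exists_partialDist_eq [Nonempty X] (g : Equiv.Perm (Fin ℓ → X)) (i : Fin ℓ) (x x' : X) :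
    ∃ u v w, hammingDist (g (joinVec i u x v)) (g (joinVec i u x' w)) = partialDist g i x x' := by
  obtain ⟨u, hu⟩ := exists_eq_ciInf_of_finite (f := fun u => partialDistAt g i u x x')
  obtain ⟨p, hp⟩ := exists_eq_ciInf_of_finite
    (f := fun p : ({j : Fin ℓ // i < j} → X) × ({j : Fin ℓ // i < j} → X) =>
      hammingDist (g (joinVec i u x p.1)) (g (joinVec i u x' p.2)))
  exact ⟨u, p.1, p.2, hp.trans hu⟩

omit [Fintype X] in
theorem partialDist_le (g : Equiv.Perm (Fin ℓ → X)) (i : Fin ℓ) (u : {j : Fin ℓ // j < i} → X)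
    (x x' : X) (v w : {j : Fin ℓ // i < j} → X) :
    partialDist g i x x' ≤ hammingDist (g (joinVec i u x v)) (g (joinVec i u x' w)) :=
  (ciInf_le (OrderBot.bddBelow _) u).trans (ciInf_le (OrderBot.bddBelow _) (v, w))

theorem partialDist_pos [Nonempty X] (g : Equiv.Perm (Fin ℓ → X)) (i : Fin ℓ) {x x' : X}
    (h : x ≠ x') : 0 < partialDist g i x x' := by
  obtain ⟨u, v, w, he⟩ := exists_partialDist_eq g i x x'
  exact he ▸ hammingDist_joinVec_pos g i u h v w

omit [Fintype X] in
theorem Dmin_le (g : Equiv.Perm (Fin ℓ → X)) (i : Fin ℓ) {x x' : X} (h : x ≠ x') :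
    Dmin g i ≤ partialDist g i x x' :=
  ciInf_le (f := fun p : {p : X × X // p.1 ≠ p.2} => partialDist g i p.1.1 p.1.2)
    (OrderBot.bddBelow _) ⟨(x, x'), h⟩

theorem Dmin_pos [Nontrivial X] (g : Equiv.Perm (Fin ℓ → X)) (i : Fin ℓ) : 0 < Dmin g i := by
  obtain ⟨x, x', h⟩ := exists_pair_ne X
  have : Nonempty {p : X × X // p.1 ≠ p.2} := ⟨⟨(x, x'), h⟩⟩
  obtain ⟨p, hp⟩ := exists_eq_ciInf_of_finite
    (f := fun p : {p : X × X // p.1 ≠ p.2} => partialDist g i p.1.1 p.1.2)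
  exact (partialDist_pos g i p.2).trans_eq hp

theorem le_Dmax (g : Equiv.Perm (Fin ℓ → X)) (i : Fin ℓ) (x x' : X) :
    partialDist g i x x' ≤ Dmax g i :=
  le_ciSup (f := fun p : X × X => partialDist g i p.1 p.2) (Set.finite_range _).bddAbove (x, x')

theorem Dmax_pos [Nontrivial X] (g : Equiv.Perm (Fin ℓ → X)) (i : Fin ℓ) : 0 < Dmax g i := by
  obtain ⟨x, x', h⟩ := exists_pair_ne X
  exact (partialDist_pos g i h).trans_le (le_Dmax g i x x')

end PolarKernel

/-! ### Comparing entropy with square roots of products -/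

section Sqrt

variable {ι : Type*} [Fintype ι]

/-- Write log(s/a) as 2 log √(s/a) and use log r ≤ r - 1. -/
theorem mul_log_sub_log_le {a s : ℝ} (ha : 0 ≤ a) (hs : a ≤ s) :
    a * (Real.log s - Real.log a) ≤ 2 * (√a * √s - a) := by
  rcases ha.eq_or_lt with h | h
  · simp [← h]
  · have hs0 : 0 < s := h.trans_le hs
    have h1 := Real.log_le_sub_one_of_pos (show 0 < √s / √a by positivity)
    rw [Real.log_div (by positivity) (by positivity), Real.log_sqrt hs0.le, Real.log_sqrt ha] at h1
    have h2 : a * (√s / √a) = √a * √s := by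
      nth_rewrite 1 [← Real.mul_self_sqrt ha]
      field_simp
    nlinarith

theorem sqrt_sum_le {a : ι → ℝ} (ha : ∀ x, 0 ≤ a x) : √(∑ x, a x) ≤ ∑ x, √(a x) := by
  refine Real.sqrt_le_iff.2 ⟨Finset.sum_nonneg fun x _ => Real.sqrt_nonneg _, ?_⟩
  rw [sq, Finset.sum_mul]
  refine Finset.sum_le_sum fun x _ => ?_
  nth_rewrite 1 [← Real.mul_self_sqrt (ha x)]
  exact mul_le_mul_of_nonneg_left (Finset.single_le_sum (f := fun x => √(a x))
    (fun i _ => Real.sqrt_nonneg _) (Finset.mem_univ x)) (Real.sqrt_nonneg _)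

theorem sqrt_mul_sum_le {A B : ι → ℝ} (hA : ∀ v, 0 ≤ A v)
    (hB : ∀ v, 0 ≤ B v) : √((∑ v, A v) * ∑ w, B w) ≤ ∑ v, ∑ w, √(A v * B w) := by
  rw [Finset.sum_mul_sum]
  refine (sqrt_sum_le fun v => Finset.sum_nonneg fun w _ => mul_nonneg (hA v) (hB w)).trans ?_
  exact Finset.sum_le_sum fun v _ => sqrt_sum_le fun w => mul_nonneg (hA v) (hB w)

theorem entropyGap_le_sum_sqrt [DecidableEq ι] {a : ι → ℝ} (ha : ∀ x, 0 ≤ a x) :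
    entropyGap a ≤ 2 * ∑ p : ι × ι with p.1 ≠ p.2, √(a p.1 * a p.2) := by
  have hs := sqrt_sum_le ha
  rw [entropyGap_eq_sum, Finset.sum_filter, Fintype.sum_prod_type, Finset.mul_sum]
  refine Finset.sum_le_sum fun x _ => (mul_log_sub_log_le (ha x)
    (Finset.single_le_sum (fun i _ => ha i) (Finset.mem_univ x))).trans ?_
  have h1 : ∑ x', (if x ≠ x' then √(a x * a x') else 0) = √(a x) * ∑ x', √(a x') - a x := by
    rw [Finset.mul_sum, eq_sub_iff_add_eq, ← Finset.add_sum_erase _ _ (Finset.mem_univ x),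
      ← Finset.add_sum_erase _ (fun x' => √(a x) * √(a x')) (Finset.mem_univ x),
      Real.mul_self_sqrt (ha x), if_neg (by simp), zero_add, add_comm]
    congr 1
    refine Finset.sum_congr rfl fun x' hx' => ?_
    rw [if_pos (Finset.ne_of_mem_erase hx').symm, Real.sqrt_mul (ha x)]
  dsimp only
  rw [h1]
  have := mul_le_mul_of_nonneg_left hs (Real.sqrt_nonneg (a x))
  linarith

/-- The smaller of two weights is at most half of the total, so its own entropy term already has
logarithm at least log 2. -/
theorem mul_log_two_le_entropyGap {a : ι → ℝ} (ha : ∀ x, 0 ≤ a x) {x x' : ι} (h : x ≠ x')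
    (hle : a x ≤ a x') : a x * Real.log 2 ≤ entropyGap a := by
  classical
  rw [entropyGap_eq_sum]
  refine le_trans ?_ (Finset.single_le_sum (fun i _ => entropyGap_term_nonneg ha i)
    (Finset.mem_univ x))
  rcases (ha x).eq_or_lt with h0 | h0
  · simp [← h0]
  refine mul_le_mul_of_nonneg_left ?_ h0.le
  rw [le_sub_iff_add_le, ← Real.log_mul (by norm_num) h0.ne']
  refine Real.log_le_log (by positivity) ?_
  have h1 := Finset.add_le_sum (f := a) (s := Finset.univ) (fun i _ => ha i) (Finset.mem_univ x)
    (Finset.mem_univ x') h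
  linarith

/-- The smaller weight is controlled by the entropy and the larger one by the total mass. The
product is then rebalanced by ε and bounded through √(AB) ≤ A + B. -/
theorem sqrt_mul_le_entropyGap {a : ι → ℝ} (ha : ∀ x, 0 ≤ a x) {x x' : ι} (h : x ≠ x')
    {ε : ℝ} (hε : 0 < ε) :
    √(a x * a x') ≤ ε * ∑ x, a x + entropyGap a / (ε * Real.log 2) := by
  wlog hle : a x ≤ a x' generalizing x x'
  · rw [mul_comm]
    exact this h.symm (le_of_not_ge hle)
  have h2 : 0 < Real.log 2 := Real.log_pos (by norm_num)
  have hs0 : 0 ≤ ∑ x, a x := Finset.sum_nonneg fun i _ => ha i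
  have hK := entropyGap_nonneg ha
  have h3 : a x ≤ entropyGap a / Real.log 2 :=
    (le_div_iff₀ h2).2 (mul_log_two_le_entropyGap ha h hle)
  have h4 : a x' ≤ ∑ x, a x := Finset.single_le_sum (fun i _ => ha i) (Finset.mem_univ x')
  have h5 : a x * a x' ≤ (entropyGap a / (ε * Real.log 2)) * (ε * ∑ x, a x) := by
    calc _ ≤ entropyGap a / Real.log 2 * ∑ x, a x :=
          mul_le_mul h3 h4 (ha _) (by positivity)
      _ = _ := by field_simp
  have h6 : 0 ≤ entropyGap a / (ε * Real.log 2) := by positivity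
  have h7 : 0 ≤ ε * ∑ x, a x := by positivity
  refine Real.sqrt_le_iff.2 ⟨by positivity, h5.trans ?_⟩
  nlinarith

end Sqrt

/-! ### Bhattacharyya parameters and their one-step bounds -/

namespace DMC

variable {X : Type u}

theorem summable_bhatt (W : DMC X) (x x' : X) :
    Summable fun y => √(W.prob x y * W.prob x' y) := by
  refine Summable.of_nonneg_of_le (fun y => Real.sqrt_nonneg _) (fun y => ?_)
    ((W.prob_hasSum x).summable.add (W.prob_hasSum x').summable)
  have h1 := W.prob_nonneg x y
  have h2 := W.prob_nonneg x' y
  refine Real.sqrt_le_iff.2 ⟨by positivity, ?_⟩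
  nlinarith [mul_nonneg h1 h2]

theorem bhatt_nonneg (W : DMC X) (x x' : X) : 0 ≤ W.bhatt x x' :=
  tsum_nonneg fun _ => Real.sqrt_nonneg _

theorem bhatt_self (W : DMC X) (x : X) : W.bhatt x x = 1 := by
  unfold bhatt
  simp only [Real.sqrt_mul_self (W.prob_nonneg x _)]
  exact (W.prob_hasSum x).tsum_eq

theorem bhatt_le_one (W : DMC X) (x x' : X) : W.bhatt x x' ≤ 1 := by
  have hs := ((W.prob_hasSum x).add (W.prob_hasSum x')).div_const 2
  have h := (W.summable_bhatt x x').tsum_le_tsum (fun y => ?_) hs.summable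
  · rw [hs.tsum_eq] at h
    exact h.trans_eq (by norm_num)
  · have h1 := W.prob_nonneg x y
    have h2 := W.prob_nonneg x' y
    refine Real.sqrt_le_iff.2 ⟨by positivity, ?_⟩
    nlinarith [sq_nonneg (W.prob x y - W.prob x' y)]

theorem hasSum_prod_bhatt (W : DMC X) {ℓ : ℕ} (a b : Fin ℓ → X) :
    HasSum (fun y : Fin ℓ → W.Out => √((∏ j, W.prob (a j) (y j)) * ∏ j, W.prob (b j) (y j)))
      (∏ j, W.bhatt (a j) (b j)) := by
  have h := hasSum_pi_prod ℓ (fun j y => √(W.prob (a j) y * W.prob (b j) y)) _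
    fun j => (W.summable_bhatt (a j) (b j)).hasSum
  refine h.congr_fun fun y => ?_
  rw [← Finset.prod_mul_distrib]
  exact Real.sqrt_prod _ fun j _ => mul_nonneg (W.prob_nonneg _ _) (W.prob_nonneg _ _)

theorem prod_bhatt_eq [DecidableEq X] (W : DMC X) {ℓ : ℕ} (a b : Fin ℓ → X) :
    ∏ j, W.bhatt (a j) (b j) = ∏ j with a j ≠ b j, W.bhatt (a j) (b j) := by
  rw [Finset.prod_filter]
  refine Finset.prod_congr rfl fun j _ => ?_
  split_ifs with h
  · rfl
  · rw [not_not] at h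
    rw [h, bhatt_self]

theorem prod_bhatt_le [DecidableEq X] (W : DMC X) {ℓ : ℕ} {z : ℝ}
    (hz : ∀ x x', x ≠ x' → W.bhatt x x' ≤ z) (a b : Fin ℓ → X) :
    ∏ j, W.bhatt (a j) (b j) ≤ z ^ hammingDist a b := by
  rw [prod_bhatt_eq, hammingDist, ← Finset.prod_const]
  exact Finset.prod_le_prod (fun j _ => W.bhatt_nonneg _ _)
    fun j hj => hz _ _ (Finset.mem_filter.1 hj).2

theorem le_prod_bhatt [DecidableEq X] (W : DMC X) {ℓ : ℕ} {z : ℝ} (hz0 : 0 ≤ z)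
    (hz : ∀ x x', z ≤ W.bhatt x x') (a b : Fin ℓ → X) :
    z ^ hammingDist a b ≤ ∏ j, W.bhatt (a j) (b j) := by
  rw [prod_bhatt_eq, hammingDist, ← Finset.prod_const]
  exact Finset.prod_le_prod (fun j _ => hz0) fun j _ => hz _ _

variable [Fintype X]

section Sub

variable [Nonempty X] {ℓ : ℕ}

omit [Nonempty X] in
theorem card_joinVec (i : Fin ℓ) :
    (Fintype.card ({j : Fin ℓ // j < i} → X) : ℝ) * Fintype.card X *
      Fintype.card ({j : Fin ℓ // i < j} → X) = (Fintype.card X : ℝ) ^ ℓ := by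
  have := Fintype.card_congr (joinEquiv (X := X) i)
  rw [Fintype.card_prod, Fintype.card_prod, Fintype.card_fun (α := Fin ℓ), Fintype.card_fin] at this
  rw [mul_assoc]
  exact_mod_cast this

theorem bhatt_sub_eq (W : DMC X) (g : Equiv.Perm (Fin ℓ → X)) (i : Fin ℓ) (x x' : X) :
    (W.sub g i).bhatt x x' = ∑' y, ∑ u, √((W.sub g i).prob x (y, u) * (W.sub g i).prob x' (y, u)) ∧
    Summable fun y => ∑ u, √((W.sub g i).prob x (y, u) * (W.sub g i).prob x' (y, u)) := by
  have h : Summable fun z : (Fin ℓ → W.Out) × ({j : Fin ℓ // j < i} → X) =>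
    √((W.sub g i).prob x z * (W.sub g i).prob x' z) := (W.sub g i).summable_bhatt x x'
  constructor
  · exact h.tsum_prod.trans (tsum_congr fun y => tsum_fintype _)
  · exact h.prod.congr fun y => tsum_fintype _

theorem sqrt_prob_sub (W : DMC X) (g : Equiv.Perm (Fin ℓ → X)) (i : Fin ℓ) (x x' : X)
    (y : Fin ℓ → W.Out) (u : {j : Fin ℓ // j < i} → X) :
    √((W.sub g i).prob x (y, u) * (W.sub g i).prob x' (y, u)) =
      1 / (Fintype.card X : ℝ) ^ (ℓ - 1) *
        √((∑ v, ∏ j, W.prob (g (joinVec i u x v) j) (y j)) *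
          ∑ w, ∏ j, W.prob (g (joinVec i u x' w) j) (y j)) := by
  simp only [sub]
  rw [mul_mul_mul_comm, Real.sqrt_mul (by positivity), Real.sqrt_mul_self (by positivity)]

/-- Subadditivity of the square root turns the parameter of the subchannel into a sum over pairs of
input vectors. Each pair contributes a product over the coordinates where the codewords differ, of
which there are at least `Dmin`. -/
theorem bhatt_sub_le [DecidableEq X] (W : DMC X) (g : Equiv.Perm (Fin ℓ → X)) (i : Fin ℓ) {z : ℝ}
    (hz0 : 0 ≤ z) (hz1 : z ≤ 1) (hz : ∀ x x', x ≠ x' → W.bhatt x x' ≤ z) {x x' : X}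
    (hx : x ≠ x') :
    (W.sub g i).bhatt x x' ≤ (Fintype.card X : ℝ) ^ ℓ * z ^ PolarKernel.Dmin g i := by
  have hq : (1 : ℝ) ≤ Fintype.card X := by exact_mod_cast Fintype.card_pos
  set c : ℝ := 1 / (Fintype.card X : ℝ) ^ (ℓ - 1) with hc
  have hc0 : 0 ≤ c := by positivity
  have hp : ∀ (a : Fin ℓ → X) (y : Fin ℓ → W.Out), 0 ≤ ∏ j, W.prob (a j) (y j) := fun a y =>
    Finset.prod_nonneg fun j _ => W.prob_nonneg _ _
  have hS := hasSum_sum (s := Finset.univ) fun (u : {j : Fin ℓ // j < i} → X)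
    (_ : u ∈ Finset.univ) => (hasSum_sum (s := Finset.univ)
      fun (v : {j : Fin ℓ // i < j} → X) (_ : v ∈ Finset.univ) =>
      hasSum_sum (s := Finset.univ) fun (w : {j : Fin ℓ // i < j} → X) (_ : w ∈ Finset.univ) =>
        W.hasSum_prod_bhatt (g (joinVec i u x v)) (g (joinVec i u x' w))).mul_left c
  have h1 : (W.sub g i).bhatt x x' ≤ ∑ u, c * ∑ v, ∑ w,
      ∏ j, W.bhatt (g (joinVec i u x v) j) (g (joinVec i u x' w) j) := by
    rw [(W.bhatt_sub_eq g i x x').1, ← hS.tsum_eq]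
    refine (W.bhatt_sub_eq g i x x').2.tsum_le_tsum (fun y => ?_) hS.summable
    refine Finset.sum_le_sum fun u _ => ?_
    rw [sqrt_prob_sub]
    exact mul_le_mul_of_nonneg_left (sqrt_mul_sum_le (fun v => hp _ _) fun w => hp _ _) hc0
  have h2 : ∑ u, c * ∑ v, ∑ w,
      ∏ j, W.bhatt (g (joinVec i u x v) j) (g (joinVec i u x' w) j) ≤
      ∑ _u : {j : Fin ℓ // j < i} → X, c * ∑ _v : {j : Fin ℓ // i < j} → X,
        ∑ _w : {j : Fin ℓ // i < j} → X, z ^ PolarKernel.Dmin g i := by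
    refine Finset.sum_le_sum fun u _ => mul_le_mul_of_nonneg_left (Finset.sum_le_sum fun v _ =>
      Finset.sum_le_sum fun w _ => (W.prod_bhatt_le hz _ _).trans ?_) hc0
    exact pow_le_pow_of_le_one hz0 hz1
      ((PolarKernel.Dmin_le g i hx).trans (PolarKernel.partialDist_le g i u x x' v w))
  refine (h1.trans h2).trans ?_
  have hcard := card_joinVec (X := X) i
  simp only [Finset.sum_const, Finset.card_univ, nsmul_eq_mul]
  set M : ℝ := (Fintype.card ({j : Fin ℓ // j < i} → X) : ℝ)
  set N : ℝ := (Fintype.card ({j : Fin ℓ // i < j} → X) : ℝ)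
  have hM : 1 ≤ M := by
    simp only [M]; exact_mod_cast Fintype.card_pos
  have hN : 0 ≤ N := by positivity
  have hNle : N ≤ (Fintype.card X : ℝ) ^ ℓ := by
    rw [← hcard]
    exact le_mul_of_one_le_left hN (one_le_mul_of_one_le_of_one_le hM hq)
  -- There are q^(ℓ-1) choices of prefix and suffix together, which cancels the normalization. Only
  -- the second suffix remains uncounted, and it costs at most q^ℓ.
  have hcMN : c * M * N = 1 := by
    have h5 : (Fintype.card X : ℝ) ^ ℓ = (Fintype.card X : ℝ) * (Fintype.card X : ℝ) ^ (ℓ - 1) := by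
      rw [← pow_succ']
      congr 1
      have := i.2
      omega
    have h6 : M * N = (Fintype.card X : ℝ) ^ (ℓ - 1) := by
      have : (Fintype.card X : ℝ) * (M * N) = Fintype.card X * (Fintype.card X : ℝ) ^ (ℓ - 1) := by
        rw [← h5, ← hcard]; ring
      exact mul_left_cancel₀ (by positivity) this
    rw [mul_assoc, h6, hc]
    field_simp
  calc M * (c * (N * (N * z ^ PolarKernel.Dmin g i)))
      = (c * M * N) * (N * z ^ PolarKernel.Dmin g i) := by ring
    _ ≤ _ := by
      rw [hcMN, one_mul]
      exact mul_le_mul_of_nonneg_right hNle (by positivity)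

theorem le_bhatt_sub [DecidableEq X] (W : DMC X) (g : Equiv.Perm (Fin ℓ → X)) (i : Fin ℓ) {z : ℝ}
    (hz0 : 0 ≤ z) (hz : ∀ x x', z ≤ W.bhatt x x') (x x' : X) :
    1 / (Fintype.card X : ℝ) ^ ℓ * z ^ PolarKernel.Dmax g i ≤ (W.sub g i).bhatt x x' := by
  have hq : (1 : ℝ) ≤ Fintype.card X := by exact_mod_cast Fintype.card_pos
  have hz1 : z ≤ 1 := (hz x x).trans (W.bhatt_le_one x x)
  set c : ℝ := 1 / (Fintype.card X : ℝ) ^ (ℓ - 1) with hc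
  have hc0 : 0 ≤ c := by positivity
  have hp : ∀ (a : Fin ℓ → X) (y : Fin ℓ → W.Out), 0 ≤ ∏ j, W.prob (a j) (y j) := fun a y =>
    Finset.prod_nonneg fun j _ => W.prob_nonneg _ _
  -- Only the prefix and the two suffixes attaining the partial distance are kept; all other terms
  -- of the sums are nonnegative.
  obtain ⟨u, v, w, hd⟩ := PolarKernel.exists_partialDist_eq g i x x'
  have hS := (W.hasSum_prod_bhatt (g (joinVec i u x v)) (g (joinVec i u x' w))).mul_left c
  have h1 : c * ∏ j, W.bhatt (g (joinVec i u x v) j) (g (joinVec i u x' w) j) ≤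
      (W.sub g i).bhatt x x' := by
    rw [(W.bhatt_sub_eq g i x x').1, ← hS.tsum_eq]
    refine hS.summable.tsum_le_tsum (fun y => ?_) (W.bhatt_sub_eq g i x x').2
    refine le_trans ?_ (Finset.single_le_sum (fun u _ => Real.sqrt_nonneg _) (Finset.mem_univ u))
    rw [sqrt_prob_sub]
    refine mul_le_mul_of_nonneg_left (Real.sqrt_le_sqrt ?_) hc0
    exact mul_le_mul
      (Finset.single_le_sum (f := fun v => ∏ j, W.prob (g (joinVec i u x v) j) (y j))
        (fun v _ => hp _ _) (Finset.mem_univ v))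
      (Finset.single_le_sum (f := fun v => ∏ j, W.prob (g (joinVec i u x' v) j) (y j))
        (fun v _ => hp _ _) (Finset.mem_univ w))
      (hp _ _) (Finset.sum_nonneg fun v _ => hp _ _)
  refine le_trans ?_ h1
  refine mul_le_mul ?_ ?_ (by positivity) hc0
  · exact one_div_le_one_div_of_le (by positivity) (pow_le_pow_right₀ hq (Nat.sub_le _ _))
  · refine le_trans ?_ (W.le_prod_bhatt hz0 hz _ _)
    rw [hd]
    exact pow_le_pow_of_le_one hz0 hz1 (PolarKernel.le_Dmax g i x x')

end Sub

theorem Zmin_le_bhatt (W : DMC X) (x x' : X) : W.Zmin ≤ W.bhatt x x' :=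
  ciInf_le (f := fun p : X × X => W.bhatt p.1 p.2) (Set.finite_range _).bddBelow (x, x')

theorem card_filter_ne [DecidableEq X] :
    ((Finset.univ.filter fun p : X × X => p.1 ≠ p.2).card : ℝ) =
      (Fintype.card X : ℝ) * ((Fintype.card X : ℝ) - 1) := by
  have h := Finset.card_filter_add_card_filter_not (s := (Finset.univ : Finset (X × X)))
    (fun p => p.1 = p.2)
  have hd : (Finset.univ.filter fun p : X × X => p.1 = p.2).card = Fintype.card X := by
    have he : (Finset.univ.filter fun p : X × X => p.1 = p.2) = Finset.univ.diag := by
      ext p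
      simp [Finset.mem_diag]
    rw [he, Finset.diag_card, Finset.card_univ]
  rw [hd, Finset.card_univ, Fintype.card_prod] at h
  have h' : (Fintype.card X : ℝ) + (Finset.univ.filter fun p : X × X => ¬ p.1 = p.2).card =
    Fintype.card X * Fintype.card X := by exact_mod_cast h
  simp only [ne_eq]
  linarith

/-! ### The averaged parameter against the capacity -/

section Z

variable [DecidableEq X] [Nontrivial X]

omit [DecidableEq X] in
theorem card_mul_pos : 0 < (Fintype.card X : ℝ) * ((Fintype.card X : ℝ) - 1) := by
  have : (1 : ℝ) < Fintype.card X := by exact_mod_cast Fintype.one_lt_card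
  nlinarith

theorem Z_le (W : DMC X) {z : ℝ} (hz : ∀ x x', x ≠ x' → W.bhatt x x' ≤ z) : W.Z ≤ z := by
  have h := Finset.sum_le_card_nsmul (Finset.univ.filter fun p : X × X => p.1 ≠ p.2)
    (fun p => W.bhatt p.1 p.2) z fun p hp => hz _ _ (Finset.mem_filter.1 hp).2
  rw [nsmul_eq_mul, card_filter_ne] at h
  rw [Z, one_div, inv_mul_le_iff₀ card_mul_pos]
  exact h

theorem le_Z (W : DMC X) {z : ℝ} (hz : ∀ x x', z ≤ W.bhatt x x') : z ≤ W.Z := by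
  have h := Finset.card_nsmul_le_sum (Finset.univ.filter fun p : X × X => p.1 ≠ p.2)
    (fun p => W.bhatt p.1 p.2) z fun p hp => hz _ _
  rw [nsmul_eq_mul, card_filter_ne] at h
  rw [Z, one_div, le_inv_mul_iff₀ card_mul_pos]
  exact h

/-- A channel with small Bhattacharyya parameter has small conditional entropy. -/
theorem condEnt_le_Z (W : DMC X) : W.condEnt ≤ 2 * ((Fintype.card X : ℝ) - 1) * W.Z := by
  have hS := (hasSum_sum (s := Finset.univ.filter fun p : X × X => p.1 ≠ p.2) fun p _ =>
    ((W.summable_bhatt p.1 p.2).hasSum.mul_left (1 / (Fintype.card X : ℝ)))).mul_left 2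
  have h := W.summable_entropyGap.tsum_le_tsum (fun y => ?_) hS.summable
  · rw [hS.tsum_eq, ← Finset.mul_sum] at h
    refine h.trans_eq ?_
    have h1 := (card_mul_pos (X := X)).ne'
    unfold Z bhatt
    field_simp
    rw [mul_div_cancel_right₀ _ (right_ne_zero_of_mul h1)]
  · refine (entropyGap_le_sum_sqrt fun x => W.weight_nonneg x y).trans_eq ?_
    congr 1
    refine Finset.sum_congr rfl fun p _ => ?_
    rw [mul_mul_mul_comm, Real.sqrt_mul (by positivity), Real.sqrt_mul_self (by positivity)]

omit [DecidableEq X] in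
/-- A channel with small conditional entropy has small Bhattacharyya parameters. -/
theorem bhatt_le_condEnt (W : DMC X) {x x' : X} (h : x ≠ x') {ε : ℝ} (hε : 0 < ε) :
    W.bhatt x x' ≤ Fintype.card X * (ε + W.condEnt / (ε * Real.log 2)) := by
  have hq : (0 : ℝ) < Fintype.card X := by exact_mod_cast Fintype.card_pos
  have hR := (W.hasSum_avg.mul_left ε).add (W.summable_entropyGap.hasSum.div_const (ε * Real.log 2))
  have hL := (W.summable_bhatt x x').mul_left (1 / (Fintype.card X : ℝ))
  have h1 := hL.tsum_le_tsum (fun y => ?_) hR.summable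
  · rw [hR.tsum_eq, tsum_mul_left, mul_one, one_div_mul_eq_div, div_le_iff₀' hq] at h1
    exact h1
  · refine le_trans (le_of_eq (Eq.symm ?_)) (sqrt_mul_le_entropyGap (fun x => W.weight_nonneg x y) h hε)
    rw [mul_mul_mul_comm, Real.sqrt_mul (by positivity), Real.sqrt_mul_self (by positivity)]

omit [DecidableEq X] in
theorem exists_capacity_bhatt {z : ℝ} (hz : 0 < z) : ∃ δ : ℝ, 0 < δ ∧
    ∀ W : DMC X, 1 - δ < W.capacity → ∀ x x', x ≠ x' → W.bhatt x x' ≤ z := by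
  have hq : (0 : ℝ) < Fintype.card X := by exact_mod_cast Fintype.card_pos
  have hl : 0 < Real.log (Fintype.card X) :=
    Real.log_pos (by exact_mod_cast Fintype.one_lt_card)
  have h2 : 0 < Real.log 2 := Real.log_pos (by norm_num)
  -- With this ε, conditional entropy at most ε² log 2 makes both terms of `bhatt_le_condEnt` at
  -- most ε inside the bracket, and q · 2ε = z.
  set ε : ℝ := z / (2 * Fintype.card X) with hε
  have hε0 : 0 < ε := by positivity
  refine ⟨ε * (ε * Real.log 2) / Real.log (Fintype.card X), by positivity,
    fun W hW x x' h => (W.bhatt_le_condEnt h hε0).trans ?_⟩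
  rw [capacity_eq, sub_lt_sub_iff_left, div_lt_div_iff_of_pos_right hl] at hW
  have h3 : W.condEnt / (ε * Real.log 2) ≤ ε := (div_le_iff₀ (by positivity)).2 hW.le
  calc _ ≤ Fintype.card X * (ε + ε) := by gcongr
    _ = z := by rw [hε]; field_simp; ring

theorem exists_Z_capacity : ∃ δ : ℝ, 0 < δ ∧ ∀ W : DMC X, W.Z < δ → 1 / 2 < W.capacity := by
  have hq : (0 : ℝ) < (Fintype.card X : ℝ) - 1 := by
    rw [sub_pos]; exact_mod_cast Fintype.one_lt_card
  have hl : 0 < Real.log (Fintype.card X) :=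
    Real.log_pos (by exact_mod_cast Fintype.one_lt_card)
  refine ⟨Real.log (Fintype.card X) / (4 * ((Fintype.card X : ℝ) - 1)), by positivity,
    fun W hW => ?_⟩
  rw [lt_div_iff₀ (by positivity)] at hW
  have h1 : W.condEnt / Real.log (Fintype.card X) < 1 / 2 := by
    rw [div_lt_iff₀ hl]
    refine W.condEnt_le_Z.trans_lt ?_
    linarith
  rw [capacity_eq]
  linarith

end Z

end DMC

/-! ### Random paths: independence and martingales -/

section Path

variable {Ω : Type*} [MeasurableSpace Ω] {P : Measure Ω} {ℓ : ℕ} {B : ℕ → Ω → Fin ℓ}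

theorem exists_comp_restrict {β : Type*} [Nonempty β] {S : Finset ℕ} {F : (ℕ → Fin ℓ) → β}
    (hF : DependsOn F S) : ∃ φ : (S → Fin ℓ) → β, ∀ b, F b = φ fun i => b i := by
  obtain ⟨φ, hφ⟩ := dependsOn_iff_exists_comp.1 hF
  exact ⟨φ, fun b => congrFun hφ b⟩

theorem measurable_of_dependsOn (hB : ∀ n, Measurable (B n)) {β : Type*} [Nonempty β]
    [MeasurableSpace β] {S : Finset ℕ} {F : (ℕ → Fin ℓ) → β} (hF : DependsOn F S) :
    Measurable fun ω => F fun k => B k ω := by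
  obtain ⟨φ, hφ⟩ := exists_comp_restrict hF
  simp only [hφ]
  exact (measurable_of_countable φ).comp (measurable_pi_lambda _ fun i => hB i)

theorem integrable_of_dependsOn [IsFiniteMeasure P] (hB : ∀ n, Measurable (B n)) {S : Finset ℕ}
    {F : (ℕ → Fin ℓ) → ℝ} (hF : DependsOn F S) : Integrable (fun ω => F fun k => B k ω) P := by
  obtain ⟨φ, hφ⟩ := exists_comp_restrict hF
  simp only [hφ]
  exact (Integrable.of_finite (f := φ)).comp_measurable (measurable_pi_lambda _ fun i => hB i)

theorem indepFun_of_dependsOn (hB : ∀ n, Measurable (B n)) (hI : iIndepFun B P)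
    {β γ : Type*} [Nonempty β] [Nonempty γ] [MeasurableSpace β] [MeasurableSpace γ]
    {S T : Finset ℕ} (hST : Disjoint S T) {F : (ℕ → Fin ℓ) → β} {G : (ℕ → Fin ℓ) → γ}
    (hF : DependsOn F S) (hG : DependsOn G T) :
    IndepFun (fun ω => F fun k => B k ω) (fun ω => G fun k => B k ω) P := by
  obtain ⟨φ, hφ⟩ := exists_comp_restrict hF
  obtain ⟨ψ, hψ⟩ := exists_comp_restrict hG
  simp only [hφ, hψ]
  exact (hI.indepFun_finset S T hST hB).comp (measurable_of_countable φ)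
    (measurable_of_countable ψ)

theorem real_and_eq_mul (hB : ∀ n, Measurable (B n)) (hI : iIndepFun B P)
    {S T : Finset ℕ} (hST : Disjoint S T) {p r : (ℕ → Fin ℓ) → Prop}
    (hp : DependsOn p S) (hr : DependsOn r T) :
    P.real {ω | (p fun k => B k ω) ∧ r fun k => B k ω} =
      P.real {ω | p fun k => B k ω} * P.real {ω | r fun k => B k ω} := by
  have h := (indepFun_of_dependsOn hB hI hST hp hr).measure_inter_preimage_eq_mul {True} {True}
    (measurableSet_singleton _) (measurableSet_singleton _)
  have h' : ∀ s : (ℕ → Fin ℓ) → Prop, (fun ω => s fun k => B k ω) ⁻¹' {True} =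
    {ω | s fun k => B k ω} := fun s => by ext ω; simp
  rw [h', h'] at h
  rw [Measure.real, Measure.real, Measure.real, ← ENNReal.toReal_mul, ← h]
  rfl

theorem integral_comp_eq_sum [IsProbabilityMeasure P] (hB : ∀ n, Measurable (B n))
    (hU : ∀ n k, P.real {ω | B n ω = k} = 1 / (ℓ : ℝ)) (n : ℕ) (φ : Fin ℓ → ℝ) :
    ∫ ω, φ (B n ω) ∂P = 1 / (ℓ : ℝ) * ∑ k, φ k := by
  have := Measure.isProbabilityMeasure_map (μ := P) (hB n).aemeasurable
  rw [← integral_map (hB n).aemeasurable (measurable_of_countable φ).aestronglyMeasurable,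
    integral_fintype Integrable.of_finite, Finset.mul_sum]
  refine Finset.sum_congr rfl fun k _ => ?_
  rw [map_measureReal_apply (hB n) (measurableSet_singleton k), smul_eq_mul, ← hU n k]
  rfl

theorem identDistrib_of_uniform (hB : ∀ n, Measurable (B n)) [IsProbabilityMeasure P]
    (hU : ∀ n k, P.real {ω | B n ω = k} = 1 / (ℓ : ℝ)) (m n : ℕ) :
    IdentDistrib (B m) (B n) P P := by
  refine ⟨(hB m).aemeasurable, (hB n).aemeasurable, Measure.ext_of_singleton fun k => ?_⟩
  rw [Measure.map_apply (hB m) (measurableSet_singleton k),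
    Measure.map_apply (hB n) (measurableSet_singleton k)]
  have h := (hU m k).trans (hU n k).symm
  exact (ENNReal.toReal_eq_toReal_iff' (measure_ne_top _ _) (measure_ne_top _ _)).1 h

/-- Averaging over the last step of a path. -/
theorem integral_step [IsProbabilityMeasure P] (hB : ∀ n, Measurable (B n)) (hI : iIndepFun B P)
    (hU : ∀ n k, P.real {ω | B n ω = k} = 1 / (ℓ : ℝ)) (n : ℕ) {G : (ℕ → Fin ℓ) → Fin ℓ → ℝ}
    (hG : ∀ k, DependsOn (fun b => G b k) (Finset.range n : Finset ℕ)) :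
    ∫ ω, G (fun k => B k ω) (B n ω) ∂P =
      ∫ ω, 1 / (ℓ : ℝ) * ∑ k, G (fun k => B k ω) k ∂P := by
  have hind : ∀ k : Fin ℓ, DependsOn (fun b : ℕ → Fin ℓ => if b n = k then (1 : ℝ) else 0)
      ((Finset.Ico n (n + 1) : Finset ℕ) : Set ℕ) := by
    intro k b b' h
    simp only [h n (by simp)]
  have hdisj : Disjoint (Finset.range n) (Finset.Ico n (n + 1)) := by
    rw [Finset.range_eq_Ico]; exact Finset.Ico_disjoint_Ico_consecutive 0 n (n + 1)
  have h1 : ∀ ω, G (fun k => B k ω) (B n ω) =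
      ∑ k, G (fun k => B k ω) k * (if B n ω = k then (1 : ℝ) else 0) := by
    intro ω
    simp
  have h2 : ∀ k, IndepFun (fun ω => G (fun k => B k ω) k)
      (fun ω => if B n ω = k then (1 : ℝ) else 0) P := fun k =>
    indepFun_of_dependsOn hB hI hdisj (hG k) (hind k)
  have hi1 : ∀ k, Integrable (fun ω => G (fun k => B k ω) k) P := fun k =>
    integrable_of_dependsOn hB (hG k)
  have hi2 : ∀ k, Integrable (fun ω => if B n ω = k then (1 : ℝ) else 0) P := fun k =>
    integrable_of_dependsOn hB (hind k)
  have hi3 : ∀ k, Integrable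
      (fun ω => G (fun k => B k ω) k * (if B n ω = k then (1 : ℝ) else 0)) P := fun k =>
    (h2 k).integrable_mul (hi1 k) (hi2 k)
  simp only [h1]
  rw [integral_finsetSum _ fun k _ => hi3 k, integral_const_mul,
    integral_finsetSum _ fun k _ => hi1 k, Finset.mul_sum]
  refine Finset.sum_congr rfl fun k _ => ?_
  rw [(h2 k).integral_fun_mul_eq_mul_integral (hi1 k).aestronglyMeasurable
    (hi2 k).aestronglyMeasurable, integral_comp_eq_sum hB hU n (fun j => if j = k then (1 : ℝ) else 0)]
  simp [mul_comm]

/-- The filtration generated by the path. -/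
def pathFiltration (hB : ∀ n, Measurable (B n)) : Filtration ℕ ‹MeasurableSpace Ω› where
  seq n := MeasurableSpace.comap (fun ω (i : Finset.range n) => B i ω) inferInstance
  mono' m n hmn := by
    have h : (fun ω (i : Finset.range m) => B i ω) =
        (fun (x : Finset.range n → Fin ℓ) (i : Finset.range m) =>
          x ⟨i, Finset.range_mono hmn i.2⟩) ∘ fun ω (i : Finset.range n) => B i ω := rfl
    dsimp only
    rw [h, ← MeasurableSpace.comap_comp]
    exact MeasurableSpace.comap_mono (measurable_of_countable _).comap_le
  le' n := (measurable_pi_lambda _ fun i : Finset.range n => hB i).comap_le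

theorem martingale_path [IsProbabilityMeasure P] (hB : ∀ n, Measurable (B n)) (hI : iIndepFun B P)
    (hU : ∀ n k, P.real {ω | B n ω = k} = 1 / (ℓ : ℝ)) {F : ℕ → (ℕ → Fin ℓ) → ℝ}
    {G : ℕ → (ℕ → Fin ℓ) → Fin ℓ → ℝ} (hF : ∀ n, DependsOn (F n) (Finset.range n : Finset ℕ))
    (hG : ∀ n k, DependsOn (fun b => G n b k) (Finset.range n : Finset ℕ))
    (hstep : ∀ n b, F (n + 1) b = G n b (b n))
    (hmean : ∀ n b, 1 / (ℓ : ℝ) * ∑ k, G n b k = F n b) :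
    Martingale (fun n ω => F n fun k => B k ω) (pathFiltration hB) P := by
  refine martingale_of_setIntegral_eq_succ (fun n => ?_)
    (fun n => integrable_of_dependsOn hB (hF n)) fun n s hs => ?_
  · obtain ⟨φ, hφ⟩ := exists_comp_restrict (hF n)
    simp only [hφ]
    exact Measurable.stronglyMeasurable ((measurable_of_countable φ).comp (comap_measurable _))
  · obtain ⟨t, ht, rfl⟩ := hs
    have hms : MeasurableSet ((fun ω (i : Finset.range n) => B i ω) ⁻¹' t) :=
      (measurable_pi_lambda _ fun i : Finset.range n => hB i) ht
    classical
    -- Cutting `G` off outside the event, which depends only on the first `n` steps, turns the set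
    -- integrals into full integrals covered by `integral_step`.
    set H : (ℕ → Fin ℓ) → Fin ℓ → ℝ := fun b k =>
      if (fun i : Finset.range n => b i) ∈ t then G n b k else 0 with hH
    have hHd : ∀ k, DependsOn (fun b => H b k) (Finset.range n : Finset ℕ) := by
      intro k b b' h
      have h1 : (fun i : Finset.range n => b i) = fun i : Finset.range n => b' i :=
        funext fun i => h i i.2
      have h2 : G n b k = G n b' k := hG n k h
      simp only [hH, h1, h2]
    have h := integral_step hB hI hU n hHd
    rw [← integral_indicator hms, ← integral_indicator hms]
    refine Eq.trans (integral_congr_ae (ae_of_all _ fun ω => ?_))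
      (h.symm.trans (integral_congr_ae (ae_of_all _ fun ω => ?_)))
    · by_cases hω : (fun i : Finset.range n => B i ω) ∈ t
      · simp only [hH, Set.indicator, Set.mem_preimage, hω, if_true, hmean]
      · simp [hH, Set.indicator, Set.mem_preimage, hω]
    · by_cases hω : (fun i : Finset.range n => B i ω) ∈ t
      · simp only [hH, Set.indicator, Set.mem_preimage, hω, if_true, hstep]
      · simp [hH, Set.indicator, Set.mem_preimage, hω]

end Path

/-! ### Sequences converging to a {0,1}-valued limit -/

section Limit

variable {Ω : Type*} [MeasurableSpace Ω] {P : Measure Ω} [IsProbabilityMeasure P]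

theorem integrable_of_mem_Icc {M : Ω → ℝ} (hM : AEStronglyMeasurable M P)
    (h01 : ∀ᵐ ω ∂P, M ω ∈ Set.Icc (0 : ℝ) 1) : Integrable M P :=
  Integrable.of_bound hM 1 (h01.mono fun ω h => by
    rw [Real.norm_eq_abs, abs_of_nonneg h.1]; exact h.2)

theorem tendsto_integral_abs_sub_of_ae {f : ℕ → Ω → ℝ} {L : Ω → ℝ}
    (hf : ∀ n, Measurable (f n)) (hf01 : ∀ n ω, f n ω ∈ Set.Icc (0 : ℝ) 1)
    (hL01 : ∀ᵐ ω ∂P, L ω ∈ Set.Icc (0 : ℝ) 1)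
    (h : ∀ᵐ ω ∂P, Tendsto (fun n => f n ω) atTop (𝓝 (L ω))) :
    Tendsto (fun n => ∫ ω, |f n ω - L ω| ∂P) atTop (𝓝 0) := by
  have hLm : AEStronglyMeasurable L P :=
    aestronglyMeasurable_of_tendsto_ae atTop (fun n => (hf n).aestronglyMeasurable) h
  have h0 : (0 : ℝ) = ∫ _ω, (0 : ℝ) ∂P := by simp
  rw [h0]
  refine tendsto_integral_of_dominated_convergence (fun _ => 1)
    (fun n => ((hf n).aestronglyMeasurable.sub hLm).norm) (integrable_const 1) (fun n => ?_) ?_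
  · filter_upwards [hL01] with ω hω
    have := hf01 n ω
    rw [Real.norm_eq_abs, abs_abs, abs_le]
    constructor <;> linarith [this.1, this.2, hω.1, hω.2]
  · filter_upwards [h] with ω hω
    have := (hω.sub_const (L ω)).abs
    simpa using this

variable {M : ℕ → Ω → ℝ} {L : Ω → ℝ}

theorem tendsto_indicator_lt {a : ℝ} (ha0 : 0 < a) (ha1 : a < 1) {x : ℕ → ℝ} {l : ℝ}
    (hl : l ∈ ({0, 1} : Set ℝ)) (h : Tendsto x atTop (𝓝 l)) :
    Tendsto (fun n => if a < x n then (1 : ℝ) else 0) atTop (𝓝 l) := by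
  rcases hl with rfl | hl
  · refine tendsto_const_nhds.congr' ?_
    filter_upwards [h.eventually (gt_mem_nhds ha0)] with n hn
    rw [if_neg (not_lt.2 (le_of_lt hn))]
  · rw [Set.mem_singleton_iff] at hl
    subst hl
    refine tendsto_const_nhds.congr' ?_
    filter_upwards [h.eventually (lt_mem_nhds ha1)] with n hn
    rw [if_pos hn]

omit [IsProbabilityMeasure P] in
theorem integral_indicator_lt {f : Ω → ℝ} (hf : Measurable f) (a : ℝ) :
    ∫ ω, (if a < f ω then (1 : ℝ) else 0) ∂P = P.real {ω | a < f ω} := by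
  have hm : MeasurableSet {ω | a < f ω} := measurableSet_lt measurable_const hf
  rw [← integral_indicator_one hm]
  rfl

/-- As the limit takes only the values 0 and 1, the indicator of `a < M n` has the same limit as `M
n`. Dominated convergence then identifies both limiting means with `c`. -/
theorem tendsto_real_lt_of_tendsto_zero_one (hM : ∀ n, Measurable (M n))
    (hM01 : ∀ n ω, M n ω ∈ Set.Icc (0 : ℝ) 1)
    (hL : ∀ᵐ ω ∂P, L ω ∈ ({0, 1} : Set ℝ))
    (h : ∀ᵐ ω ∂P, Tendsto (fun n => M n ω) atTop (𝓝 (L ω))) {c : ℝ}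
    (hc : ∀ n, ∫ ω, M n ω ∂P = c) {a : ℝ} (ha0 : 0 < a) (ha1 : a < 1) :
    Tendsto (fun n => P.real {ω | a < M n ω}) atTop (𝓝 c) := by
  have h1 : Tendsto (fun n => ∫ ω, M n ω ∂P) atTop (𝓝 (∫ ω, L ω ∂P)) := by
    refine tendsto_integral_of_dominated_convergence (fun _ => 1)
      (fun n => (hM n).aestronglyMeasurable) (integrable_const 1) (fun n => ?_) h
    refine ae_of_all _ fun ω => ?_
    rw [Real.norm_eq_abs, abs_of_nonneg (hM01 n ω).1]
    exact (hM01 n ω).2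
  have h2 : ∫ ω, L ω ∂P = c := by
    simp only [hc] at h1
    exact tendsto_nhds_unique h1 tendsto_const_nhds |>.symm ▸ rfl
  rw [← h2]
  simp only [← integral_indicator_lt (P := P) (hM _) a]
  refine tendsto_integral_of_dominated_convergence (fun _ => 1) (fun n => ?_)
    (integrable_const 1) (fun n => ?_) ?_
  · exact (Measurable.ite (measurableSet_lt measurable_const (hM n)) measurable_const
      measurable_const).aestronglyMeasurable
  · refine ae_of_all _ fun ω => ?_
    split_ifs <;> simp
  · filter_upwards [h, hL] with ω h1 h2
    exact tendsto_indicator_lt ha0 ha1 h2 h1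

/-- The indicators at times `n` and `m` are both close in L¹ to the same limit, hence to each other.
This allows the event at a late time to be replaced by one at a fixed time. -/
theorem exists_real_lt_and_le_le (hM : ∀ n, Measurable (M n))
    (hL : ∀ᵐ ω ∂P, L ω ∈ ({0, 1} : Set ℝ))
    (h : ∀ᵐ ω ∂P, Tendsto (fun n => M n ω) atTop (𝓝 (L ω))) {a : ℝ} (ha0 : 0 < a) (ha1 : a < 1)
    {ε : ℝ} (hε : 0 < ε) :
    ∃ N, ∀ m ≥ N, ∀ n ≥ N, P.real {ω | a < M n ω ∧ M m ω ≤ a} ≤ ε := by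
  set f : ℕ → Ω → ℝ := fun n ω => if a < M n ω then (1 : ℝ) else 0 with hf
  have hfm : ∀ n, Measurable (f n) := fun n =>
    Measurable.ite (measurableSet_lt measurable_const (hM n)) measurable_const measurable_const
  have hf01 : ∀ n ω, f n ω ∈ Set.Icc (0 : ℝ) 1 := fun n ω => by
    simp only [hf]; split_ifs <;> simp
  have hfL : ∀ᵐ ω ∂P, Tendsto (fun n => f n ω) atTop (𝓝 (L ω)) := by
    filter_upwards [h, hL] with ω h1 h2
    exact tendsto_indicator_lt ha0 ha1 h2 h1
  have hL01 : ∀ᵐ ω ∂P, L ω ∈ Set.Icc (0 : ℝ) 1 := by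
    filter_upwards [hL] with ω hω
    rcases hω with h | h
    · simp [h]
    · rw [Set.mem_singleton_iff] at h; simp [h]
  have hLm : AEStronglyMeasurable L P :=
    aestronglyMeasurable_of_tendsto_ae atTop (fun n => (hfm n).aestronglyMeasurable) hfL
  have hLi := integrable_of_mem_Icc hLm hL01
  have hfi : ∀ n, Integrable (f n) P := fun n =>
    integrable_of_mem_Icc (hfm n).aestronglyMeasurable (ae_of_all _ (hf01 n))
  have hd : ∀ n, Integrable (fun ω => |f n ω - L ω|) P := fun n => ((hfi n).sub hLi).abs
  have ht := tendsto_integral_abs_sub_of_ae hfm hf01 hL01 hfL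
  obtain ⟨N, hN⟩ := eventually_atTop.1 (ht.eventually (gt_mem_nhds (half_pos hε)))
  refine ⟨N, fun m hm n hn => ?_⟩
  have hms : MeasurableSet {ω | a < M n ω ∧ M m ω ≤ a} :=
    (measurableSet_lt measurable_const (hM n)).inter (measurableSet_le (hM m) measurable_const)
  rw [← integral_indicator_one hms]
  calc _ ≤ ∫ ω, (|f n ω - L ω| + |f m ω - L ω|) ∂P := by
        refine integral_mono ((integrable_const 1).indicator hms) ((hd n).add (hd m)) fun ω => ?_
        by_cases hω : a < M n ω ∧ M m ω ≤ a
        · have h1 : f n ω = 1 := if_pos hω.1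
          have h2 : f m ω = 0 := if_neg (not_lt.2 hω.2)
          rw [Set.indicator_of_mem (by exact hω)]
          simp only [h1, h2, Pi.one_apply]
          calc (1 : ℝ) = (1 - L ω) - (0 - L ω) := by ring
            _ ≤ |(1 - L ω) - (0 - L ω)| := le_abs_self _
            _ ≤ _ := abs_sub _ _
        · rw [Set.indicator_of_notMem (by exact hω)]
          positivity
    _ ≤ ε := by
        rw [integral_add (hd n) (hd m)]
        linarith [hN n hn, hN m hm]

end Limit

/-! ### The capacity martingale -/

namespace DMC

variable {X : Type u} [Fintype X] {ℓ : ℕ}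

theorem dependsOn_iter [Nonempty X] (W : DMC X) (g : Equiv.Perm (Fin ℓ → X)) (n : ℕ) :
    DependsOn (fun b => W.iter g b n) (Finset.range n : Finset ℕ) := by
  induction n with
  | zero => intro b b' _; rfl
  | succ n ih =>
    intro b b' h
    have h1 : W.iter g b n = W.iter g b' n :=
      ih fun k hk => h k (by simp at hk ⊢; omega)
    have h2 : b n = b' n := h n (by simp)
    simp only [iter, h1, h2]

theorem dependsOn_iter_comp [Nonempty X] (W : DMC X) (g : Equiv.Perm (Fin ℓ → X)) (n : ℕ)
    {β : Type*} (F : DMC X → β) :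
    DependsOn (fun b => F (W.iter g b n)) (Finset.range n : Finset ℕ) := fun _ _ h =>
  congrArg F (W.dependsOn_iter g n h)

variable {Ω : Type*} [MeasurableSpace Ω] {P : Measure Ω} [IsProbabilityMeasure P]
  {B : ℕ → Ω → Fin ℓ}

/-- The symmetric capacities along a random path form a martingale. -/
theorem martingale_capacity [Nontrivial X] (hℓ : 0 < ℓ) (W : DMC X) (g : Equiv.Perm (Fin ℓ → X))
    (hB : ∀ n, Measurable (B n)) (hI : iIndepFun B P)
    (hU : ∀ n k, P.real {ω | B n ω = k} = 1 / (ℓ : ℝ)) :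
    Martingale (fun n ω => (W.iter g (fun k => B k ω) n).capacity) (pathFiltration hB) P := by
  refine martingale_path (F := fun n b => (W.iter g b n).capacity)
    (G := fun n b k => ((W.iter g b n).sub g k).capacity) hB hI hU
    (fun n => W.dependsOn_iter_comp g n capacity)
    (fun n k => W.dependsOn_iter_comp g n fun V => (V.sub g k).capacity) (fun n b => rfl)
    fun n b => ?_
  rw [sum_capacity_sub]
  have : (ℓ : ℝ) ≠ 0 := by exact_mod_cast hℓ.ne'
  field_simp

theorem integral_capacity_iter [Nontrivial X] (hℓ : 0 < ℓ) (W : DMC X)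
    (g : Equiv.Perm (Fin ℓ → X)) (hB : ∀ n, Measurable (B n)) (hI : iIndepFun B P)
    (hU : ∀ n k, P.real {ω | B n ω = k} = 1 / (ℓ : ℝ)) (n : ℕ) :
    ∫ ω, (W.iter g (fun k => B k ω) n).capacity ∂P = W.capacity := by
  have h := (W.martingale_capacity hℓ g hB hI hU).setIntegral_eq (Nat.zero_le n)
    MeasurableSet.univ
  simp only [setIntegral_univ] at h
  rw [← h]
  simp [iter]

theorem ae_tendsto_Iinf [Nontrivial X] (hℓ : 0 < ℓ) (W : DMC X)
    (g : Equiv.Perm (Fin ℓ → X)) (hB : ∀ n, Measurable (B n)) (hI : iIndepFun B P)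
    (hU : ∀ n k, P.real {ω | B n ω = k} = 1 / (ℓ : ℝ)) :
    ∀ᵐ ω ∂P, Tendsto (fun n => (W.iter g (fun k => B k ω) n).capacity) atTop
      (𝓝 (W.Iinf g fun k => B k ω)) := by
  have h := (W.martingale_capacity hℓ g hB hI hU).submartingale.exists_ae_tendsto_of_bdd (R := 1) ?_
  · filter_upwards [h] with ω ⟨l, hω⟩
    rw [Iinf, hω.limUnder_eq]
    exact hω
  · intro n
    refine (eLpNorm_le_of_ae_bound (C := 1) (ae_of_all _ fun ω => ?_)).trans (by simp)
    rw [Real.norm_eq_abs, abs_of_nonneg (capacity_nonneg _)]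
    exact capacity_le_one _

end DMC

/-! ### Central limit theorem with a delayed start and a small shift -/

section CentralLimit

theorem gaussianReal_Ioi_toReal (t : ℝ) :
    (gaussianReal 0 1 (Set.Ioi t)).toReal = gaussQ t := by
  rw [gaussianReal_apply_eq_integral 0 one_ne_zero, ENNReal.toReal_ofReal
    (setIntegral_nonneg measurableSet_Ioi fun x _ => gaussianPDFReal_nonneg _ _ _), gaussQ,
    ← integral_const_mul]
  refine setIntegral_congr_fun measurableSet_Ioi fun x _ => ?_
  simp [gaussianPDFReal, neg_div]

theorem gaussQ_nonneg (t : ℝ) : 0 ≤ gaussQ t := by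
  rw [← gaussianReal_Ioi_toReal]
  exact ENNReal.toReal_nonneg

theorem gaussQ_le_one (t : ℝ) : gaussQ t ≤ 1 := by
  rw [← gaussianReal_Ioi_toReal]
  exact measureReal_le_one

variable {Ω : Type*} [MeasurableSpace Ω] {P : Measure Ω} [IsProbabilityMeasure P]
  {ℓ : ℕ} {B : ℕ → Ω → Fin ℓ}

theorem tendsto_real_lt_sum (hB : ∀ n, Measurable (B n)) (hI : iIndepFun B P)
    (hU : ∀ n k, P.real {ω | B n ω = k} = 1 / (ℓ : ℝ)) (d : Fin ℓ → ℝ) {E V : ℝ}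
    (hE : E = 1 / (ℓ : ℝ) * ∑ k, d k) (hV : V = 1 / (ℓ : ℝ) * ∑ k, (d k - E) ^ 2) (hV0 : 0 < V)
    (t : ℝ) (m : ℕ) {h : ℕ → ℝ} (hh : h =o[atTop] fun n : ℕ => √(n : ℝ)) :
    Tendsto (fun n : ℕ => P.real {ω | E * n + t * √(V * n) + h n <
      ∑ k ∈ Finset.Ico m n, d (B k ω)}) atTop (𝓝 (gaussQ t)) := by
  have hs : 0 < √V := Real.sqrt_pos.2 hV0
  -- For `ℓ = 0` the convention 1/0 = 0 would make the variance zero.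
  have hℓ : (ℓ : ℝ) ≠ 0 := by
    rintro h0
    rw [h0] at hV
    simp at hV
    exact hV0.ne' hV
  set φ : Fin ℓ → ℝ := fun k => (d k - E) / √V with hφ
  set ξ : ℕ → Ω → ℝ := fun k ω => φ (B k ω) with hξ
  have hφm : Measurable φ := measurable_of_countable φ
  have hξm : ∀ k, Measurable (ξ k) := fun k => hφm.comp (hB k)
  have h0 : P[ξ 0] = 0 := by
    simp only [hξ]
    rw [integral_comp_eq_sum hB hU]
    simp only [hφ, ← Finset.sum_div, Finset.sum_sub_distrib, Finset.sum_const, Finset.card_univ,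
      Fintype.card_fin, nsmul_eq_mul]
    rw [hE]
    field_simp
    simp
  have h1 : P[ξ 0 ^ 2] = 1 := by
    simp only [hξ, Pi.pow_apply]
    rw [integral_comp_eq_sum hB hU 0 fun k => φ k ^ 2]
    simp only [hφ, div_pow, Real.sq_sqrt hV0.le, ← Finset.sum_div]
    rw [← mul_div_assoc, ← hV, div_self hV0.ne']
  have hclt := tendstoInDistribution_inv_sqrt_mul_sum (Y := id) (P' := gaussianReal 0 1)
    HasLaw.id h0 h1
    (hI.comp (fun _ => φ) fun _ => hφm)
    (fun i => (identDistrib_of_uniform hB hU i 0).comp hφm)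
  -- The omitted first `m` terms and the shift, both divided by √(V n). For each ω this tends to 0,
  -- so Slutsky's theorem leaves the Gaussian limit unchanged.
  set r : ℕ → Ω → ℝ := fun n ω =>
    (√(n : ℝ))⁻¹ * ((-∑ k ∈ Finset.range m, d (B k ω) - h n) / √V) with hr
  have hrm : ∀ n, Measurable (r n) := fun n => by
    have : ∀ k, Measurable fun ω => d (B k ω) := fun k => (measurable_of_countable d).comp (hB k)
    fun_prop
  have hr0 : TendstoInMeasure P r atTop fun _ => (0 : ℝ) := by
    refine tendstoInMeasure_of_tendsto_ae (fun n => (hrm n).aestronglyMeasurable)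
      (ae_of_all _ fun ω => ?_)
    have hsq : Tendsto (fun n : ℕ => (√(n : ℝ))⁻¹) atTop (𝓝 0) :=
      tendsto_inv_atTop_zero.comp (Real.tendsto_sqrt_atTop.comp tendsto_natCast_atTop_atTop)
    have ha := hsq.mul_const ((-∑ k ∈ Finset.range m, d (B k ω)) / √V)
    have hb := hh.tendsto_div_nhds_zero.div_const √V
    have hab := ha.sub hb
    rw [zero_mul, zero_div, sub_zero] at hab
    refine hab.congr fun n => ?_
    simp only [hr]
    ring
  have hsum := hclt.add_of_tendstoInMeasure_const hr0 fun n => (hrm n).aemeasurable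
  have hmap : (gaussianReal 0 1).map (fun ω : ℝ => id ω + 0) = gaussianReal 0 1 := by
    simp
  have hport := ProbabilityMeasure.tendsto_measure_of_null_frontier_of_tendsto' hsum.tendsto
    (E := Set.Ioi t) (by
      have := nullSingletonClass_gaussianReal (μ := 0) (v := 1) one_ne_zero
      rw [frontier_Ioi]
      simp)
  simp only [ProbabilityMeasure.coe_mk, hmap] at hport
  have hport2 := (ENNReal.tendsto_toReal (measure_ne_top _ _)).comp hport
  rw [gaussianReal_Ioi_toReal] at hport2
  refine hport2.congr' ?_
  filter_upwards [eventually_ge_atTop (max m 1)] with n hn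
  have hn0 : (0 : ℝ) < n := by exact_mod_cast (le_max_right m 1).trans hn
  have hmn : m ≤ n := (le_max_left m 1).trans hn
  have hsn : 0 < √(n : ℝ) := Real.sqrt_pos.2 hn0
  simp only [Function.comp_apply]
  rw [Measure.map_apply (by
    have := hrm n
    fun_prop) measurableSet_Ioi, Measure.real]
  congr 2
  ext ω
  simp only [Set.mem_preimage, Set.mem_Ioi, Set.mem_ofPred_eq, Pi.add_apply, hr, hξ, hφ]
  rw [← mul_add, ← Finset.sum_div, ← add_div, ← div_eq_inv_mul, div_div,
    lt_div_iff₀ (by positivity), Finset.sum_sub_distrib, Finset.sum_const, Finset.card_range,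
    nsmul_eq_mul, Real.sqrt_mul hV0.le, ← Finset.sum_range_add_sum_Ico _ hmn]
  constructor <;> intro hlt <;> linarith

end CentralLimit

/-! ### Products of distances along a path -/

section PathSums

variable {ℓ : ℕ}

/-- The product `D(b_m) ⋯ D(b_{n-1})`. -/
def pathProd (D : Fin ℓ → ℕ) (b : ℕ → Fin ℓ) (m n : ℕ) : ℝ := ∏ k ∈ Finset.Ico m n, (D (b k) : ℝ)

/-- The sum of the inverses of the partial products of `D(b_m), …, D(b_{n-1})`. -/
def invPathSum (D : Fin ℓ → ℕ) (b : ℕ → Fin ℓ) (m n : ℕ) : ℝ :=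
  ∑ k ∈ Finset.Ico m n, (pathProd D b m (k + 1))⁻¹

variable {D : Fin ℓ → ℕ}

theorem pathProd_self (b : ℕ → Fin ℓ) (m : ℕ) : pathProd D b m m = 1 := by simp [pathProd]

theorem pathProd_succ (b : ℕ → Fin ℓ) {m n : ℕ} (h : m ≤ n) :
    pathProd D b m (n + 1) = pathProd D b m n * D (b n) := by
  rw [pathProd, Finset.prod_Ico_succ_top h, pathProd]

theorem invPathSum_self (b : ℕ → Fin ℓ) (m : ℕ) : invPathSum D b m m = 0 := by simp [invPathSum]

theorem invPathSum_succ (b : ℕ → Fin ℓ) {m n : ℕ} (h : m ≤ n) :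
    invPathSum D b m (n + 1) = invPathSum D b m n + (pathProd D b m (n + 1))⁻¹ := by
  rw [invPathSum, Finset.sum_Ico_succ_top h, invPathSum]

theorem one_le_pathProd (hD : ∀ i, 0 < D i) (b : ℕ → Fin ℓ) (m n : ℕ) : 1 ≤ pathProd D b m n := by
  have : ∀ k ∈ Finset.Ico m n, (1 : ℝ) ≤ D (b k) := fun k _ => by exact_mod_cast hD (b k)
  calc (1 : ℝ) = ∏ _k ∈ Finset.Ico m n, (1 : ℝ) := by simp
    _ ≤ _ := Finset.prod_le_prod (fun _ _ => zero_le_one) this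

theorem invPathSum_nonneg (hD : ∀ i, 0 < D i) (b : ℕ → Fin ℓ) (m n : ℕ) :
    0 ≤ invPathSum D b m n :=
  Finset.sum_nonneg fun _ _ =>
    inv_nonneg.2 (zero_le_one.trans (one_le_pathProd hD b _ _))

theorem pathProd_eq_rpow (hℓ : 2 ≤ ℓ) (hD : ∀ i, 0 < D i) (b : ℕ → Fin ℓ) (m n : ℕ) :
    pathProd D b m n = (ℓ : ℝ) ^ ∑ k ∈ Finset.Ico m n, Real.logb ℓ (D (b k)) := by
  have h0 : (0 : ℝ) < ℓ := by exact_mod_cast (by omega : 0 < ℓ)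
  have h1 : (ℓ : ℝ) ≠ 1 := by exact_mod_cast (by omega : ℓ ≠ 1)
  rw [Real.rpow_sum_of_pos h0, pathProd]
  exact Finset.prod_congr rfl fun k _ =>
    (Real.rpow_logb h0 h1 (by exact_mod_cast hD (b k))).symm

/-- The sum of all distances is a crude bound for each of the first `m` factors. Only its
independence of `n` and of the path matters. -/
theorem pathProd_zero_le (hD : ∀ i, 0 < D i) (b : ℕ → Fin ℓ) {m n : ℕ} (h : m ≤ n) :
    pathProd D b 0 n ≤ (∑ i, (D i : ℝ)) ^ m * pathProd D b m n := by
  have h1 : pathProd D b 0 n = pathProd D b 0 m * pathProd D b m n :=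
    (Finset.prod_Ico_consecutive _ (Nat.zero_le m) h).symm
  rw [h1]
  refine mul_le_mul_of_nonneg_right ?_ (zero_le_one.trans (one_le_pathProd hD b m n))
  calc pathProd D b 0 m ≤ ∏ _k ∈ Finset.Ico 0 m, ∑ i, (D i : ℝ) :=
        Finset.prod_le_prod (fun _ _ => by positivity) fun k _ =>
          Finset.single_le_sum (f := fun i => (D i : ℝ)) (fun i _ => by positivity)
            (Finset.mem_univ (b k))
    _ = _ := by simp

theorem dependsOn_pathProd (D : Fin ℓ → ℕ) (m n : ℕ) :
    DependsOn (fun b => pathProd D b m n) (Finset.Ico m n : Finset ℕ) := fun b b' h =>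
  Finset.prod_congr rfl fun k hk => by rw [h k (by simpa using hk)]

theorem dependsOn_invPathSum (D : Fin ℓ → ℕ) (m n : ℕ) :
    DependsOn (fun b => invPathSum D b m n) (Finset.Ico m n : Finset ℕ) := fun b b' h =>
  Finset.sum_congr rfl fun k hk => by
    refine congrArg _ (dependsOn_pathProd D m (k + 1) fun j hj => h j ?_)
    simp only [Finset.coe_Ico, Set.mem_Ico, Finset.mem_Ico] at hj hk ⊢
    omega

theorem dependsOn_sum_path (d : Fin ℓ → ℝ) (m n : ℕ) :
    DependsOn (fun b : ℕ → Fin ℓ => ∑ k ∈ Finset.Ico m n, d (b k))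
      (Finset.Ico m n : Finset ℕ) := fun b b' h =>
  Finset.sum_congr rfl fun k hk => by rw [h k (by simpa using hk)]

theorem exists_one_lt_of_logVar_pos (hD : ∀ i, 0 < D i) (hV : 0 < PolarKernel.logVar D) :
    ∃ i, 1 < D i := by
  by_contra! h
  have h1 : ∀ i, D i = 1 := fun i => le_antisymm (h i) (hD i)
  simp [PolarKernel.logVar, PolarKernel.logMean, h1] at hV

theorem logMean_pos (hℓ : 2 ≤ ℓ) (hD : ∀ i, 0 < D i) (hV : 0 < PolarKernel.logVar D) :
    0 < PolarKernel.logMean D := by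
  obtain ⟨i, hi⟩ := exists_one_lt_of_logVar_pos hD hV
  have hl : (1 : ℝ) < ℓ := by exact_mod_cast (by omega : 1 < ℓ)
  refine mul_pos (by positivity) (Finset.sum_pos' (fun j _ => ?_) ⟨i, Finset.mem_univ i, ?_⟩)
  · exact Real.logb_nonneg hl (by exact_mod_cast hD j)
  · exact Real.logb_pos hl (by exact_mod_cast hi)

/-- The average of `1 / D_i`. -/
def invMean (D : Fin ℓ → ℕ) : ℝ := 1 / (ℓ : ℝ) * ∑ i, (D i : ℝ)⁻¹

theorem invMean_nonneg : 0 ≤ invMean D := by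
  unfold invMean
  positivity

/-- Positive variance excludes that all distances equal 1, so at least one inverse is strictly below
1. This is what makes the geometric series for the mean of `invPathSum` converge. -/
theorem invMean_lt_one (hℓ : 2 ≤ ℓ) (hD : ∀ i, 0 < D i) (hV : 0 < PolarKernel.logVar D) :
    invMean D < 1 := by
  obtain ⟨i, hi⟩ := exists_one_lt_of_logVar_pos hD hV
  have hl : (0 : ℝ) < ℓ := by exact_mod_cast (by omega : 0 < ℓ)
  have h : ∑ i, (D i : ℝ)⁻¹ < ∑ _i : Fin ℓ, (1 : ℝ) := by
    refine Finset.sum_lt_sum (fun j _ => ?_) ⟨i, Finset.mem_univ i, ?_⟩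
    · exact inv_le_one_of_one_le₀ (by exact_mod_cast hD j)
    · exact inv_lt_one_of_one_lt₀ (by exact_mod_cast hi)
  rw [Finset.sum_const, Finset.card_univ, Fintype.card_fin, nsmul_eq_mul, mul_one] at h
  rw [invMean, one_div, inv_mul_lt_iff₀ hl, mul_one]
  exact h

variable {Ω : Type*} [MeasurableSpace Ω] {P : Measure Ω} [IsProbabilityMeasure P]
  {B : ℕ → Ω → Fin ℓ}

theorem integral_inv_pathProd (hB : ∀ n, Measurable (B n)) (hI : iIndepFun B P)
    (hU : ∀ n k, P.real {ω | B n ω = k} = 1 / (ℓ : ℝ)) (D : Fin ℓ → ℕ) (m j : ℕ) :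
    ∫ ω, (pathProd D (fun k => B k ω) m (m + j))⁻¹ ∂P = invMean D ^ j := by
  induction j with
  | zero => simp [pathProd_self]
  | succ j ih =>
    have h := integral_step hB hI hU (m + j)
      (G := fun b k => (pathProd D b m (m + j))⁻¹ * (D k : ℝ)⁻¹) fun k b b' hb => by
        have h1 : pathProd D b m (m + j) = pathProd D b' m (m + j) :=
          dependsOn_pathProd D m (m + j) fun i hi => hb i (by simp at hi ⊢; omega)
        simp only [h1]
    rw [← add_assoc]
    simp only [pathProd_succ _ (Nat.le_add_right m j), mul_inv]
    rw [h, pow_succ, ← ih, ← integral_mul_const]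
    refine integral_congr_ae (ae_of_all _ fun ω => ?_)
    simp only [← Finset.mul_sum, invMean]
    ring

theorem integral_invPathSum_le (hB : ∀ n, Measurable (B n)) (hI : iIndepFun B P)
    (hU : ∀ n k, P.real {ω | B n ω = k} = 1 / (ℓ : ℝ)) (hD : invMean D < 1) (m n : ℕ) :
    ∫ ω, invPathSum D (fun k => B k ω) m n ∂P ≤ (1 - invMean D)⁻¹ := by
  have h0 := invMean_nonneg (D := D)
  have hi : ∀ k, Integrable (fun ω => (pathProd D (fun k => B k ω) m (k + 1))⁻¹) P := fun k =>
    integrable_of_dependsOn hB (F := fun b => (pathProd D b m (k + 1))⁻¹) fun b b' h =>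
      congrArg _ (dependsOn_pathProd D m (k + 1) h)
  unfold invPathSum
  rw [integral_finsetSum _ fun k _ => hi k, Finset.sum_Ico_eq_sum_range]
  simp only [add_assoc, integral_inv_pathProd hB hI hU]
  calc ∑ i ∈ Finset.range (n - m), invMean D ^ (i + 1)
      ≤ ∑ i ∈ Finset.range (n - m), invMean D ^ i :=
        Finset.sum_le_sum fun i _ => pow_le_pow_of_le_one h0 hD.le (Nat.le_succ i)
    _ ≤ _ := by
        rw [← tsum_geometric_of_lt_one h0 hD]
        exact (summable_geometric_of_lt_one h0 hD).sum_le_tsum _ fun i _ => pow_nonneg h0 i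

theorem real_le_invPathSum_le (hB : ∀ n, Measurable (B n)) (hI : iIndepFun B P)
    (hU : ∀ n k, P.real {ω | B n ω = k} = 1 / (ℓ : ℝ)) (hD0 : ∀ i, 0 < D i)
    (hD : invMean D < 1) (m n : ℕ) {a : ℝ} (ha : 0 < a) :
    P.real {ω | a ≤ invPathSum D (fun k => B k ω) m n} ≤ (1 - invMean D)⁻¹ / a := by
  rw [le_div_iff₀ ha, mul_comm]
  refine le_trans ?_ (integral_invPathSum_le hB hI hU hD m n)
  exact mul_meas_ge_le_integral_of_nonneg (ae_of_all _ fun ω => invPathSum_nonneg hD0 _ m n)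
    (integrable_of_dependsOn hB (dependsOn_invPathSum D m n)) a

end PathSums

/-! ### Iterating the one-step bounds along a path -/

namespace DMC

variable {X : Type u} [Fintype X] [DecidableEq X] [Nontrivial X] {ℓ : ℕ}

omit [DecidableEq X] in
theorem exists_two_rpow_eq (hℓ : 0 < ℓ) :
    ∃ c : ℝ, 0 < c ∧ (2 : ℝ) ^ c = (Fintype.card X : ℝ) ^ ℓ := by
  have hq : (1 : ℝ) < Fintype.card X := by exact_mod_cast Fintype.one_lt_card
  have hp : (1 : ℝ) < (Fintype.card X : ℝ) ^ ℓ := one_lt_pow₀ hq hℓ.ne'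
  exact ⟨Real.logb 2 ((Fintype.card X : ℝ) ^ ℓ), Real.logb_pos one_lt_two hp,
    Real.rpow_logb two_pos (by norm_num) (by positivity)⟩

/-- The recursion for exponents is A ↦ D·A - c. Dividing by the running product turns the loss c at
each step into c over that product, and these losses add up to `c * invPathSum`. The condition `hR`
keeps the bound at most 1, as the one-step estimate requires. -/
theorem bhatt_iter_le (W : DMC X) (g : Equiv.Perm (Fin ℓ → X)) (b : ℕ → Fin ℓ) {c : ℝ}
    (hc0 : 0 < c) (hc : (2 : ℝ) ^ c = (Fintype.card X : ℝ) ^ ℓ) {m : ℕ} {K : ℝ}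
    (hK : ∀ x x', x ≠ x' → (W.iter g b m).bhatt x x' ≤ 2 ^ (-K)) {n : ℕ} (hmn : m ≤ n)
    (hR : c * invPathSum (PolarKernel.Dmin g) b m n ≤ K) {x x' : X} (hx : x ≠ x') :
    (W.iter g b n).bhatt x x' ≤ 2 ^ (-(pathProd (PolarKernel.Dmin g) b m n *
      (K - c * invPathSum (PolarKernel.Dmin g) b m n))) := by
  induction n, hmn using Nat.le_induction generalizing x x' with
  | base => simpa [pathProd_self, invPathSum_self] using hK x x' hx
  | succ n hmn ih =>
    have hP := one_le_pathProd (PolarKernel.Dmin_pos g) b m n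
    have hP' := one_le_pathProd (PolarKernel.Dmin_pos g) b m (n + 1)
    rw [invPathSum_succ b hmn] at hR ⊢
    have hR' : c * invPathSum (PolarKernel.Dmin g) b m n ≤ K := by
      have : 0 ≤ c * (pathProd (PolarKernel.Dmin g) b m (n + 1))⁻¹ := by positivity
      linarith
    refine (bhatt_sub_le (W.iter g b n) g (b n) (by positivity) ?_
      (fun x x' h => ih hR' h) hx).trans_eq ?_
    · refine Real.rpow_le_one_of_one_le_of_nonpos one_le_two (neg_nonpos.2 ?_)
      exact mul_nonneg (by positivity) (sub_nonneg.2 hR')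
    · rw [← hc, ← Real.rpow_natCast, ← Real.rpow_mul two_pos.le, ← Real.rpow_add two_pos,
        pathProd_succ b hmn]
      rw [pathProd_succ b hmn] at hP'
      have hinv := mul_inv_cancel₀ (zero_lt_one.trans_le hP').ne'
      congr 1
      linear_combination (-c) * hinv

theorem le_bhatt_iter (W : DMC X) (g : Equiv.Perm (Fin ℓ → X)) (b : ℕ → Fin ℓ) {c : ℝ}
    (hc0 : 0 < c) (hc : (2 : ℝ) ^ c = (Fintype.card X : ℝ) ^ ℓ) {y : ℝ}
    (hy : ∀ x x', 2 ^ (-y) ≤ W.bhatt x x') (n : ℕ) (x x' : X) :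
    2 ^ (-(pathProd (PolarKernel.Dmax g) b 0 n * (y + n * c))) ≤ (W.iter g b n).bhatt x x' := by
  induction n generalizing x x' with
  | zero => simpa [pathProd_self, iter] using hy x x'
  | succ n ih =>
    have hP := one_le_pathProd (PolarKernel.Dmax_pos g) b 0 (n + 1)
    refine le_trans ?_ (le_bhatt_sub (W.iter g b n) g (b n) (by positivity) ih x x')
    rw [← hc, one_div, ← Real.rpow_neg two_pos.le, ← Real.rpow_natCast,
      ← Real.rpow_mul two_pos.le, ← Real.rpow_add two_pos]
    refine Real.rpow_le_rpow_of_exponent_le one_le_two ?_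
    -- The new loss `c` is absorbed by increasing `n * c` to `(n + 1) * c`, because the running
    -- product is at least 1.
    rw [pathProd_succ b (Nat.zero_le n)] at hP ⊢
    push_cast
    nlinarith

variable {Ω : Type*} [MeasurableSpace Ω] {P : Measure Ω} [IsProbabilityMeasure P]
  {B : ℕ → Ω → Fin ℓ}

/-- Three events are intersected: good parameters at time `m`, a large product afterwards, and a
small sum of inverses. The first is independent of the other two. Those share the same steps, so the
failure probability of the third is subtracted, by Markov's inequality. -/
theorem le_real_Z_lt (hℓ : 2 ≤ ℓ) (W : DMC X) (g : Equiv.Perm (Fin ℓ → X))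
    (hB : ∀ n, Measurable (B n)) (hI : iIndepFun B P)
    (hU : ∀ n k, P.real {ω | B n ω = k} = 1 / (ℓ : ℝ)) {c : ℝ}
    (hc0 : 0 < c) (hc : (2 : ℝ) ^ c = (Fintype.card X : ℝ) ^ ℓ)
    (hD : invMean (PolarKernel.Dmin g) < 1) {K : ℝ} (hK : 1 < K) {m n : ℕ} (hmn : m ≤ n) (a : ℝ) :
    P.real {ω | ∀ x x', x ≠ x' → (W.iter g (fun k => B k ω) m).bhatt x x' ≤ 2 ^ (-K)} *
      (P.real {ω | a < ∑ k ∈ Finset.Ico m n, Real.logb ℓ (PolarKernel.Dmin g (B k ω))} -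
        (1 - invMean (PolarKernel.Dmin g))⁻¹ / ((K - 1) / c)) ≤
    P.real {ω | (W.iter g (fun k => B k ω) n).Z < 2 ^ (-((ℓ : ℝ) ^ a))} := by
  have hl : (1 : ℝ) < ℓ := by exact_mod_cast (by omega : 1 < ℓ)
  have ha : 0 < (K - 1) / c := div_pos (sub_pos.2 hK) hc0
  have hmarkov := real_le_invPathSum_le hB hI hU (PolarKernel.Dmin_pos g) hD m n ha
  set A : (ℕ → Fin ℓ) → Prop := fun b =>
    a < ∑ k ∈ Finset.Ico m n, Real.logb ℓ (PolarKernel.Dmin g (b k)) with hA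
  set R : (ℕ → Fin ℓ) → Prop := fun b =>
    invPathSum (PolarKernel.Dmin g) b m n < (K - 1) / c with hR
  have hAR : DependsOn (fun b => A b ∧ R b) (Finset.Ico m n : Finset ℕ) := by
    intro b b' h
    have h1 := dependsOn_sum_path (fun i => Real.logb ℓ (PolarKernel.Dmin g i)) m n h
    have h2 := dependsOn_invPathSum (PolarKernel.Dmin g) m n h
    dsimp only at h1 h2
    simp only [hA, hR, h1, h2]
  have hdisj : Disjoint (Finset.range m) (Finset.Ico m n) := by
    rw [Finset.range_eq_Ico]; exact Finset.Ico_disjoint_Ico_consecutive 0 m n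
  have hprod := real_and_eq_mul (P := P) hB hI hdisj
    (W.dependsOn_iter_comp g m fun V => ∀ x x', x ≠ x' → V.bhatt x x' ≤ 2 ^ (-K)) hAR
  have hsub : P.real {ω | A fun k => B k ω} ≤ P.real {ω | (A fun k => B k ω) ∧ R fun k => B k ω} +
      P.real {ω | (K - 1) / c ≤ invPathSum (PolarKernel.Dmin g) (fun k => B k ω) m n} := by
    refine le_trans (measureReal_mono fun ω hω => ?_) (measureReal_union_le _ _)
    by_cases h : invPathSum (PolarKernel.Dmin g) (fun k => B k ω) m n < (K - 1) / c
    · exact Or.inl ⟨hω, h⟩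
    · exact Or.inr (not_lt.1 h)
  calc _ ≤ P.real {ω | ∀ x x', x ≠ x' → (W.iter g (fun k => B k ω) m).bhatt x x' ≤ 2 ^ (-K)} *
        P.real {ω | (A fun k => B k ω) ∧ R fun k => B k ω} :=
        mul_le_mul_of_nonneg_left (by linarith) measureReal_nonneg
    _ = _ := hprod.symm
    _ ≤ _ := by
        refine measureReal_mono fun ω hω => ?_
        obtain ⟨h1, h2, h3⟩ := hω
        simp only [hR] at h3
        simp only [hA] at h2
        rw [lt_div_iff₀ hc0, mul_comm] at h3
        have hZ := Z_le (W.iter g (fun k => B k ω) n) fun x x' hx =>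
          W.bhatt_iter_le g (fun k => B k ω) hc0 hc h1 hmn (by linarith) hx
        refine hZ.trans_lt (Real.rpow_lt_rpow_of_exponent_lt one_lt_two (neg_lt_neg ?_))
        have hP := pathProd_eq_rpow hℓ (PolarKernel.Dmin_pos g) (fun k => B k ω) m n
        have h4 := one_le_pathProd (PolarKernel.Dmin_pos g) (fun k => B k ω) m n
        calc (ℓ : ℝ) ^ a < pathProd (PolarKernel.Dmin g) (fun k => B k ω) m n := by
              rw [hP]; exact Real.rpow_lt_rpow_of_exponent_lt hl h2
          _ ≤ _ := le_mul_of_one_le_right (by positivity) (by linarith)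

/-- Small `Z` at time `n` forces the product of the `Dmax` values to be large. Removing the first
`m` factors and the factor `y + n * c` leaves an event on the later steps, independent of any
property of the channel at time `m`. -/
theorem real_Z_lt_and_le (hℓ : 2 ≤ ℓ) (W : DMC X) (g : Equiv.Perm (Fin ℓ → X))
    (hB : ∀ n, Measurable (B n)) (hI : iIndepFun B P) {c : ℝ}
    (hc0 : 0 < c) (hc : (2 : ℝ) ^ c = (Fintype.card X : ℝ) ^ ℓ) {y : ℝ} (hy0 : 0 ≤ y)
    (hy : ∀ x x', 2 ^ (-y) ≤ W.bhatt x x') {m n : ℕ} (hmn : m ≤ n) (hn : 0 < n) (a : ℝ)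
    (p : DMC X → Prop) :
    P.real {ω | (W.iter g (fun k => B k ω) n).Z < 2 ^ (-((ℓ : ℝ) ^ a)) ∧
      p (W.iter g (fun k => B k ω) m)} ≤
    P.real {ω | p (W.iter g (fun k => B k ω) m)} *
      P.real {ω | a - (Real.logb ℓ ((∑ i, (PolarKernel.Dmax g i : ℝ)) ^ m * (y + c)) +
        Real.logb ℓ n) < ∑ k ∈ Finset.Ico m n, Real.logb ℓ (PolarKernel.Dmax g (B k ω))} := by
  have hl : (1 : ℝ) < ℓ := by exact_mod_cast (by omega : 1 < ℓ)
  have hn0 : (1 : ℝ) ≤ n := by exact_mod_cast hn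
  have hdisj : Disjoint (Finset.range m) (Finset.Ico m n) := by
    rw [Finset.range_eq_Ico]; exact Finset.Ico_disjoint_Ico_consecutive 0 m n
  set a' := a - (Real.logb ℓ ((∑ i, (PolarKernel.Dmax g i : ℝ)) ^ m * (y + c)) + Real.logb ℓ n)
    with ha'
  have hA : DependsOn (fun b : ℕ → Fin ℓ =>
      a' < ∑ k ∈ Finset.Ico m n, Real.logb ℓ (PolarKernel.Dmax g (b k)))
      (Finset.Ico m n : Finset ℕ) := by
    intro b b' h
    have h1 := dependsOn_sum_path (fun i => Real.logb ℓ (PolarKernel.Dmax g i)) m n h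
    dsimp only at h1 ⊢
    rw [h1]
  rw [← real_and_eq_mul (P := P) hB hI hdisj (W.dependsOn_iter_comp g m p) hA]
  refine measureReal_mono fun ω hω => ⟨hω.2, ?_⟩
  set b : ℕ → Fin ℓ := fun k => B k ω with hb
  have hlt : (2 : ℝ) ^ (-(pathProd (PolarKernel.Dmax g) b 0 n * (y + n * c))) <
      2 ^ (-((ℓ : ℝ) ^ a)) :=
    (le_Z _ (W.le_bhatt_iter g b hc0 hc hy n)).trans_lt hω.1
  rw [Real.rpow_lt_rpow_left_iff one_lt_two, neg_lt_neg_iff] at hlt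
  have hS : 0 < ∑ i, (PolarKernel.Dmax g i : ℝ) :=
    Finset.sum_pos (fun i _ => by exact_mod_cast PolarKernel.Dmax_pos g i)
      ⟨b 0, Finset.mem_univ _⟩
  have hC : 0 < (∑ i, (PolarKernel.Dmax g i : ℝ)) ^ m * (y + c) := by positivity
  have hP1 := pathProd_zero_le (PolarKernel.Dmax_pos g) b hmn
  have hP0 := one_le_pathProd (PolarKernel.Dmax_pos g) b m n
  have h2 : (ℓ : ℝ) ^ a < pathProd (PolarKernel.Dmax g) b m n *
      ((∑ i, (PolarKernel.Dmax g i : ℝ)) ^ m * (y + c) * n) := by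
    refine hlt.trans_le ?_
    calc _ ≤ ((∑ i, (PolarKernel.Dmax g i : ℝ)) ^ m * pathProd (PolarKernel.Dmax g) b m n) *
          ((y + c) * n) := by
          refine mul_le_mul hP1 (by nlinarith) (by positivity) (by positivity)
      _ = _ := by ring
  have h3 := Real.logb_lt_logb hl (by positivity) h2
  rw [Real.logb_rpow (by positivity) hl.ne', Real.logb_mul (by positivity) (by positivity),
    Real.logb_mul (by positivity) (by positivity),
    pathProd_eq_rpow hℓ (PolarKernel.Dmax_pos g) b m n,
    Real.logb_rpow (by positivity) hl.ne'] at h3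
  simp only [ha']
  linarith

end DMC

/-! ### Asymptotics of the thresholds -/

theorem isLittleO_const_add_logb (C b : ℝ) :
    (fun n : ℕ => C + Real.logb b n) =o[atTop] fun n : ℕ => √(n : ℝ) := by
  refine IsLittleO.add ?_ ?_
  · exact isLittleO_const_left.2 (Or.inr (tendsto_norm_atTop_atTop.comp
      (Real.tendsto_sqrt_atTop.comp tendsto_natCast_atTop_atTop)))
  · have h := ((isLittleO_log_rpow_atTop (one_half_pos (α := ℝ))).comp_tendsto
      tendsto_natCast_atTop_atTop).const_mul_left (Real.log b)⁻¹
    refine h.congr (fun n => ?_) fun n => ?_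
    · simp [Real.logb, div_eq_inv_mul]
    · simp [Real.sqrt_eq_rpow]

theorem tendsto_mul_add_sqrt_atTop {E V : ℝ} (hE : 0 < E) (hV : 0 ≤ V) (t : ℝ) {f : ℕ → ℝ}
    (hf : f =o[atTop] fun n : ℕ => √(n : ℝ)) :
    Tendsto (fun n : ℕ => E * n + t * √(V * n) + f n) atTop atTop := by
  have hs : Tendsto (fun n : ℕ => √(n : ℝ)) atTop atTop :=
    Real.tendsto_sqrt_atTop.comp tendsto_natCast_atTop_atTop
  have h1 : Tendsto (fun n : ℕ => √(n : ℝ) * (E * √(n : ℝ) + (t * √V + f n / √(n : ℝ))))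
      atTop atTop :=
    hs.atTop_mul_atTop₀ ((hs.const_mul_atTop hE).atTop_add
      (tendsto_const_nhds.add hf.tendsto_div_nhds_zero))
  refine h1.congr' ?_
  filter_upwards [eventually_gt_atTop 0] with n hn
  have hn0 : (0 : ℝ) < n := by exact_mod_cast hn
  have hsn : √(n : ℝ) ≠ 0 := (Real.sqrt_pos.2 hn0).ne'
  have hss := Real.mul_self_sqrt hn0.le
  rw [Real.sqrt_mul hV, mul_add, mul_add, mul_div_cancel₀ _ hsn]
  linear_combination E * hss

theorem tendsto_two_rpow_neg_rpow {b : ℝ} (hb : 1 < b) {a : ℕ → ℝ} (ha : Tendsto a atTop atTop) :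
    Tendsto (fun n => (2 : ℝ) ^ (-(b ^ a n))) atTop (𝓝 0) := by
  have h1 : Tendsto (fun n => b ^ a n) atTop atTop :=
    (tendsto_rpow_atTop_of_base_gt_one b hb).comp ha
  exact (tendsto_rpow_atBot_of_base_gt_one 2 one_lt_two).comp (tendsto_neg_atTop_atBot.comp h1)

/-! ### The two bounds of the theorem -/

namespace DMC

variable {X : Type u} [Fintype X] [DecidableEq X] [Nontrivial X] {ℓ : ℕ}
  {Ω : Type*} [MeasurableSpace Ω] {P : Measure Ω} [IsProbabilityMeasure P]
  {B : ℕ → Ω → Fin ℓ}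

omit [DecidableEq X] in
theorem tendsto_real_lt_capacity (hℓ : 0 < ℓ) (W : DMC X) (g : Equiv.Perm (Fin ℓ → X))
    (hB : ∀ n, Measurable (B n)) (hI : iIndepFun B P)
    (hU : ∀ n k, P.real {ω | B n ω = k} = 1 / (ℓ : ℝ))
    (hpol : ∀ᵐ ω ∂P, W.Iinf g (fun k => B k ω) ∈ ({0, 1} : Set ℝ)) {a : ℝ} (ha0 : 0 < a)
    (ha1 : a < 1) :
    Tendsto (fun n => P.real {ω | a < (W.iter g (fun k => B k ω) n).capacity}) atTop
      (𝓝 W.capacity) :=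
  tendsto_real_lt_of_tendsto_zero_one
    (fun n => measurable_of_dependsOn hB (W.dependsOn_iter_comp g n capacity))
    (fun _ _ => ⟨capacity_nonneg _, capacity_le_one _⟩) hpol
    (W.ae_tendsto_Iinf hℓ g hB hI hU) (W.integral_capacity_iter hℓ g hB hI hU) ha0 ha1

theorem le_liminf_real_Z_lt (hℓ : 2 ≤ ℓ) (W : DMC X) (g : Equiv.Perm (Fin ℓ → X))
    (hB : ∀ n, Measurable (B n)) (hI : iIndepFun B P)
    (hU : ∀ n k, P.real {ω | B n ω = k} = 1 / (ℓ : ℝ))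
    (hpol : ∀ᵐ ω ∂P, W.Iinf g (fun k => B k ω) ∈ ({0, 1} : Set ℝ))
    (t : ℝ) {f : ℕ → ℝ} (hf : f =o[atTop] fun n : ℕ => √(n : ℝ)) (hV : 0 < PolarKernel.V₁ g) :
    W.capacity * gaussQ t ≤
      liminf (fun n : ℕ => P.real {ω | (W.iter g (fun k => B k ω) n).Z <
        (2 : ℝ) ^ (-((ℓ : ℝ) ^
          (PolarKernel.E₁ g * n + t * √(PolarKernel.V₁ g * n) + f n)))}) atTop := by
  refine le_of_forall_pos_sub_le fun ε hε => ?_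
  obtain ⟨c, hc0, hc⟩ := exists_two_rpow_eq (X := X) (by omega : 0 < ℓ)
  have hD := invMean_lt_one hℓ (PolarKernel.Dmin_pos g) hV
  set C : ℝ := (1 - invMean (PolarKernel.Dmin g))⁻¹ with hC
  have hC0 : 0 < C := inv_pos.2 (sub_pos.2 hD)
  -- Chosen so that the Markov bound on the sum of inverses equals ε/3.
  set K : ℝ := 1 + C * c / (ε / 3) with hK
  have hK1 : 1 < K := by rw [hK]; linarith [show 0 < C * c / (ε / 3) by positivity]
  have hKε : C / ((K - 1) / c) = ε / 3 := by
    rw [hK, add_sub_cancel_left]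
    field_simp
  obtain ⟨δ, hδ0, hδ⟩ := exists_capacity_bhatt (X := X)
    (show (0 : ℝ) < 2 ^ (-K) by positivity)
  -- The minimum keeps the level `1 - δ'` strictly between 0 and 1.
  set δ' := min δ (1 / 2) with hδ'
  have hδ'0 : 0 < δ' := lt_min hδ0 (by norm_num)
  have hδ'1 : δ' ≤ 1 / 2 := min_le_right _ _
  have hpm := W.tendsto_real_lt_capacity (by omega) g hB hI hU hpol
    (a := 1 - δ') (by linarith) (by linarith)
  obtain ⟨m, hm⟩ := (hpm.eventually (lt_mem_nhds
    (show W.capacity - ε / 3 < W.capacity by linarith))).exists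
  have hGm : W.capacity - ε / 3 ≤ P.real {ω | ∀ x x', x ≠ x' →
      (W.iter g (fun k => B k ω) m).bhatt x x' ≤ 2 ^ (-K)} :=
    hm.le.trans (measureReal_mono fun ω hω => hδ _ (lt_of_le_of_lt
      (sub_le_sub_left (min_le_left _ _) _) hω))
  have hclt := tendsto_real_lt_sum hB hI hU (fun i => Real.logb ℓ (PolarKernel.Dmin g i))
    (E := PolarKernel.E₁ g) (V := PolarKernel.V₁ g) rfl rfl hV t m hf
  refine le_liminf_of_le ?_ ?_
  · exact (isBoundedUnder_of ⟨1, fun n => measureReal_le_one⟩).isCoboundedUnder_ge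
  filter_upwards [eventually_ge_atTop m, hclt.eventually (lt_mem_nhds
    (show gaussQ t - ε / 3 < gaussQ t by linarith))] with n hmn hn
  refine le_trans ?_ (W.le_real_Z_lt hℓ g hB hI hU hc0 hc hD hK1 hmn _)
  rw [← hC, hKε]
  set G := P.real {ω | ∀ x x', x ≠ x' → (W.iter g (fun k => B k ω) m).bhatt x x' ≤ 2 ^ (-K)}
  have hG0 : 0 ≤ G := measureReal_nonneg
  have hG1 : G ≤ 1 := measureReal_le_one
  have hQ0 := gaussQ_nonneg t
  have hQ1 := gaussQ_le_one t
  calc W.capacity * gaussQ t - ε ≤ (G + ε / 3) * gaussQ t - ε := by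
        gcongr; linarith
    _ ≤ G * (gaussQ t - ε / 3 - ε / 3) := by nlinarith
    _ ≤ _ := mul_le_mul_of_nonneg_left (by linarith) hG0

theorem limsup_real_Z_lt_le (hℓ : 2 ≤ ℓ) (W : DMC X) (g : Equiv.Perm (Fin ℓ → X))
    (hB : ∀ n, Measurable (B n)) (hI : iIndepFun B P)
    (hU : ∀ n k, P.real {ω | B n ω = k} = 1 / (ℓ : ℝ))
    (hpol : ∀ᵐ ω ∂P, W.Iinf g (fun k => B k ω) ∈ ({0, 1} : Set ℝ))
    (t : ℝ) {f : ℕ → ℝ} (hf : f =o[atTop] fun n : ℕ => √(n : ℝ)) (hV : 0 < PolarKernel.V₂ g)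
    (hZ : 0 < W.Zmin) :
    limsup (fun n : ℕ => P.real {ω | (W.iter g (fun k => B k ω) n).Z <
        (2 : ℝ) ^ (-((ℓ : ℝ) ^
          (PolarKernel.E₂ g * n + t * √(PolarKernel.V₂ g * n) + f n)))}) atTop ≤
      W.capacity * gaussQ t := by
  refine le_of_forall_pos_le_add fun ε hε => ?_
  have hl : (1 : ℝ) < ℓ := by exact_mod_cast (by omega : 1 < ℓ)
  obtain ⟨c, hc0, hc⟩ := exists_two_rpow_eq (X := X) (by omega : 0 < ℓ)
  have hE : 0 < PolarKernel.E₂ g := logMean_pos hℓ (PolarKernel.Dmax_pos g) hV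
  -- An initial exponent for all pairs of inputs; the maximum with 0 supplies the nonnegativity
  -- needed later.
  set y : ℝ := max 0 (-Real.logb 2 W.Zmin) with hy
  have hyZ : ∀ x x', 2 ^ (-y) ≤ W.bhatt x x' := by
    intro x x'
    refine le_trans ?_ (W.Zmin_le_bhatt x x')
    rw [← Real.le_logb_iff_rpow_le one_lt_two hZ, neg_le]
    exact le_max_right _ _
  obtain ⟨δ, hδ0, hδ⟩ := exists_Z_capacity (X := X)
  obtain ⟨N, hN⟩ := exists_real_lt_and_le_le (P := P)
    (M := fun n ω => (W.iter g (fun k => B k ω) n).capacity)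
    (fun n => measurable_of_dependsOn hB (W.dependsOn_iter_comp g n capacity)) hpol
    (W.ae_tendsto_Iinf (by omega) g hB hI hU) (a := 1 / 2) (by norm_num) (by norm_num)
    (show 0 < ε / 3 by linarith)
  have hpm := W.tendsto_real_lt_capacity (by omega) g hB hI hU hpol
    (a := 1 / 2) (by norm_num) (by norm_num)
  obtain ⟨m, hm, hNm⟩ := ((hpm.eventually (gt_mem_nhds
    (show W.capacity < W.capacity + ε / 3 by linarith))).and (eventually_ge_atTop N)).exists
  -- The initial segment and the factor `y + n * c` enter as a constant plus a logarithm of `n`, so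
  -- the shift stays o(√n).
  set h : ℕ → ℝ := fun n => f n - (Real.logb ℓ
    ((∑ i, (PolarKernel.Dmax g i : ℝ)) ^ m * (y + c)) + Real.logb ℓ n) with hh
  have hho : h =o[atTop] fun n : ℕ => √(n : ℝ) := hf.sub (isLittleO_const_add_logb _ _)
  have hclt := tendsto_real_lt_sum hB hI hU (fun i => Real.logb ℓ (PolarKernel.Dmax g i))
    (E := PolarKernel.E₂ g) (V := PolarKernel.V₂ g) rfl rfl hV t m hho
  have hsmall := tendsto_two_rpow_neg_rpow hl (tendsto_mul_add_sqrt_atTop hE hV.le t hf)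
  refine limsup_le_of_le ?_ ?_
  · exact (isBoundedUnder_of ⟨0, fun n => measureReal_nonneg⟩).isCoboundedUnder_le
  filter_upwards [eventually_ge_atTop m, eventually_ge_atTop N, eventually_gt_atTop 0,
    hsmall.eventually (gt_mem_nhds hδ0), hclt.eventually (gt_mem_nhds
    (show gaussQ t < gaussQ t + ε / 3 by linarith))] with n hmn hNn hn hnδ hnQ
  set a := PolarKernel.E₂ g * n + t * √(PolarKernel.V₂ g * n) + f n with ha
  -- Eventually the threshold lies below δ, so small `Z` at time `n` means capacity above 1/2 at
  -- that time. Paths whose capacity at time `m` is not above 1/2 then fall into the rare crossing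
  -- event.
  have hsplit : P.real {ω | (W.iter g (fun k => B k ω) n).Z < 2 ^ (-((ℓ : ℝ) ^ a))} ≤
      P.real {ω | (W.iter g (fun k => B k ω) n).Z < 2 ^ (-((ℓ : ℝ) ^ a)) ∧
        1 / 2 < (W.iter g (fun k => B k ω) m).capacity} +
      P.real {ω | 1 / 2 < (W.iter g (fun k => B k ω) n).capacity ∧
        (W.iter g (fun k => B k ω) m).capacity ≤ 1 / 2} := by
    refine le_trans (measureReal_mono fun ω hω => ?_) (measureReal_union_le _ _)
    by_cases hcap : 1 / 2 < (W.iter g (fun k => B k ω) m).capacity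
    · exact Or.inl ⟨hω, hcap⟩
    · exact Or.inr ⟨hδ _ (lt_trans hω hnδ), not_lt.1 hcap⟩
  have hfirst := W.real_Z_lt_and_le hℓ g hB hI hc0 hc (le_max_left _ _) hyZ hmn hn a
    fun V => 1 / 2 < V.capacity
  have hS : P.real {ω | a - (Real.logb ℓ ((∑ i, (PolarKernel.Dmax g i : ℝ)) ^ m * (y + c)) +
      Real.logb ℓ n) < ∑ k ∈ Finset.Ico m n, Real.logb ℓ (PolarKernel.Dmax g (B k ω))} ≤
      gaussQ t + ε / 3 := by
    refine le_trans (le_of_eq ?_) hnQ.le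
    simp only [ha, hh, add_sub_assoc]
  have hsecond := hN m hNm n hNn
  have hp1 : P.real {ω | 1 / 2 < (W.iter g (fun k => B k ω) m).capacity} ≤ 1 := measureReal_le_one
  have hp0 : 0 ≤ P.real {ω | 1 / 2 < (W.iter g (fun k => B k ω) m).capacity} := measureReal_nonneg
  have hmul := mul_le_mul_of_nonneg_left hS hp0
  have hQ0 := gaussQ_nonneg t
  have hQ1 := gaussQ_le_one t
  nlinarith

end DMC

end

theorem mainTheorem3 {X : Type*} [Fintype X] [DecidableEq X] [Nontrivial X]
    {ℓ : ℕ} (hℓ : 2 ≤ ℓ) (g : Equiv.Perm (Fin ℓ → X)) (W : DMC X)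
    {Ω : Type*} [MeasurableSpace Ω] (P : Measure Ω) [IsProbabilityMeasure P]
    (B : ℕ → Ω → Fin ℓ) (hB_meas : ∀ n, Measurable (B n)) (hB_indep : iIndepFun B P)
    (hB_unif : ∀ n k, P.real {ω | B n ω = k} = 1 / (ℓ : ℝ))
    (hpol : ∀ᵐ ω ∂P, W.Iinf g (fun k => B k ω) ∈ ({0, 1} : Set ℝ))
    (t : ℝ) (f : ℕ → ℝ) (hf : f =o[atTop] fun n : ℕ => √(n : ℝ)) :
    (0 < PolarKernel.V₁ g →
      W.capacity * gaussQ t ≤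
        liminf (fun n : ℕ => P.real {ω | (W.iter g (fun k => B k ω) n).Z <
          (2 : ℝ) ^ (-((ℓ : ℝ) ^
            (PolarKernel.E₁ g * n + t * √(PolarKernel.V₁ g * n) + f n)))}) atTop) ∧
    (0 < PolarKernel.V₂ g → 0 < W.Zmin →
      limsup (fun n : ℕ => P.real {ω | (W.iter g (fun k => B k ω) n).Z <
          (2 : ℝ) ^ (-((ℓ : ℝ) ^
            (PolarKernel.E₂ g * n + t * √(PolarKernel.V₂ g * n) + f n)))}) atTop ≤
        W.capacity * gaussQ t) :=
  ⟨fun hV => W.le_liminf_real_Z_lt hℓ g hB_meas hB_indep hB_unif hpol t hf hV,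
    fun hV hZ => W.limsup_real_Z_lt_le hℓ g hB_meas hB_indep hB_unif hpol t hf hV hZ⟩
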